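/- Let $n,m\ge 1$ be integers. Write $M_{n,m}(\mathbb{R})$ for the $n\times m$ real matrices with the Euclidean norm of the inner product $\operatorname{tr}(x^{\mathrm T}y)$, identify $M_{n,1}(\mathbb{R})=\mathbb{R}^n$ and $M_{1,m}(\mathbb{R})=\mathbb{R}^m$, and let $S^{nm-1}$ be the unit sphere of $M_{n,m}(\mathbb{R})$ with its surface measure $du$. Let $\mathcal{K}_o^{1,m}$ be the set of compact convex sets with nonempty interior in $\mathbb{R}^m$ that contain the origin, and for $Q\in\mathcal{K}_o^{1,m}$ let $h_Q(x)=\max_{y\in Q}x\cdot y$ be its support function. A set $K\subset\mathbb{R}^n$ is a Lipschitz star body about the origin, $K\in\mathcal{L}_o^{n,1}$, if $ry\in K$ for all $y\in K$ and $r\in[0,1]$, its radial function $\rho_K(x)=\sup\{r\ge 0: rx\in K\}$ ($x\ne 0$) is finite, strictly positive and continuous on the unit sphere, and its boundary is Lipschitz (locally, in suitable orthonormal coordinates, $K$ is the region below the graph of a Lipschitz function, the graph being $\partial K$). Let $\partial^*K$ be the set of $z\in\partial K$ at which $\nabla\rho_K(z)$ exists, and let $\nu_K(z)=-\nabla\rho_K(z)/|\nabla\rho_K(z)|$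 be the outer unit normal of $K$ at $z\in\partial^*K$. For $p\ge 1$, $Q\in\mathcal{K}_o^{1,m}$ and $K\in\mathcal{L}_o^{n,1}$ put $$h_{\Pi_{p,Q}K}(x)=\Big(\int_{\partial^*K}h_Q\big(\nu_K(z)^{\mathrm T}x\big)^p\,\big(z\cdot\nu_K(z)\big)^{1-p}\,d\mathcal{H}^{n-1}(z)\Big)^{1/p},\qquad x\in M_{n,m}(\mathbb{R}),$$ and define the $m$th order $p$-integral affine surface area of $K$ by $$\Phi_{p,Q}(K)=\Big(\int_{S^{nm-1}}h_{\Pi_{p,Q}K}(u)^{-nm}\,du\Big)^{-\frac{p}{nm}},$$ both being understood as elements of $[0,\infty]$, with $0^{-1}=\infty$ and $\infty^{-1}=0$ (and $0\cdot\infty=0$). **Proposition.** Let $p\ge 1$, $Q\in\mathcal{K}_o^{1,m}$ and $K\in\mathcal{L}_o^{n,1}$. Then: (i) (Homogeneity) $\Phi_{p,bQ}(aK)=b^{p}a^{n-p}\,\Phi_{p,Q}(K)$ for all $a,b>0$. (ii) (Symmetry) $\Phi_{p,Q}(K)=\Phi_{p,-Q}(K)$. (iii) (Concavity) For all $\lambda\in[0,1]$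 and $Q_1,Q_2\in\mathcal{K}_o^{1,m}$, $$\Phi_{p,\;\lambda\cdot_pQ_1+_p(1-\lambda)\cdot_pQ_2}(K)\ \ge\ \lambda\,\Phi_{p,Q_1}(K)+(1-\lambda)\,\Phi_{p,Q_2}(K),$$ where $\lambda\cdot_pQ_1+_p(1-\lambda)\cdot_pQ_2\in\mathcal{K}_o^{1,m}$ is the $L_p$ sum, i.e. the convex body with support function $\big(\lambda h_{Q_1}^p+(1-\lambda)h_{Q_2}^p\big)^{1/p}$. (iv) (Affine invariance) $\Phi_{p,Q}(\phi K)=|\det\phi|^{\frac{n-p}{n}}\,\Phi_{p,Q}(K)$ for every $\phi\in GL(n)$. -/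

import Mathlib

open MeasureTheory Set
open scoped ENNReal Pointwise Topology

/-! ### Convex bodies and support functions -/

/-- `Q` is a convex body (compact, convex, with nonempty interior) containing the origin. -/
structure IsConvexBodyO {m : ℕ} (Q : Set (EuclideanSpace ℝ (Fin m))) : Prop where
  convex : Convex ℝ Q
  isCompact : IsCompact Q
  interior_nonempty : (interior Q).Nonempty
  zero_mem : 0 ∈ Q

/-- The support function `h_Q(x) = max {x ⬝ y : y ∈ Q}` (the maximum is attained for compact
nonempty `Q`, so it is the supremum). -/
noncomputable def supportFun {m : ℕ} (Q : Set (EuclideanSpace ℝ (Fin m)))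
    (x : EuclideanSpace ℝ (Fin m)) : ℝ :=
  sSup ((fun y => inner ℝ x y) '' Q)

/-- The function `(s h_{Q₁}^p + t h_{Q₂}^p)^{1/p}`. -/
noncomputable def lpSupport {m : ℕ} (p s : ℝ) (Q₁ : Set (EuclideanSpace ℝ (Fin m))) (t : ℝ)
    (Q₂ : Set (EuclideanSpace ℝ (Fin m))) (x : EuclideanSpace ℝ (Fin m)) : ℝ :=
  (s * supportFun Q₁ x ^ p + t * supportFun Q₂ x ^ p) ^ (1 / p)

/-- The `L_p` combination `s ·_p Q₁ +_p t ·_p Q₂`: the closed convex set with support function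
`(s h_{Q₁}^p + t h_{Q₂}^p)^{1/p}`, that is, the intersection of the half-spaces this function
prescribes. That its support function is as stated is `supportFun_lpSum_rpow`; that it is again a
convex body containing the origin is `isConvexBodyO_lpSum`. -/
def lpSum {m : ℕ} (p s : ℝ) (Q₁ : Set (EuclideanSpace ℝ (Fin m))) (t : ℝ)
    (Q₂ : Set (EuclideanSpace ℝ (Fin m))) : Set (EuclideanSpace ℝ (Fin m)) :=
  {y | ∀ x, inner ℝ x y ≤ lpSupport p s Q₁ t Q₂ x}

section lpSumFacts

theorem IsConvexBodyO.bddAbove_inner {m : ℕ} {Q : Set (EuclideanSpace ℝ (Fin m))}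
    (hQ : IsConvexBodyO Q) (x : EuclideanSpace ℝ (Fin m)) :
    BddAbove ((fun y => inner ℝ x y) '' Q) :=
  (hQ.isCompact.image (by fun_prop)).bddAbove

theorem IsConvexBodyO.inner_le {m : ℕ} {Q : Set (EuclideanSpace ℝ (Fin m))}
    (hQ : IsConvexBodyO Q) (x : EuclideanSpace ℝ (Fin m)) {y : EuclideanSpace ℝ (Fin m)}
    (hy : y ∈ Q) : inner ℝ x y ≤ supportFun Q x :=
  le_csSup (hQ.bddAbove_inner x) ⟨y, hy, rfl⟩

theorem IsConvexBodyO.supportFun_nonneg {m : ℕ} {Q : Set (EuclideanSpace ℝ (Fin m))}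
    (hQ : IsConvexBodyO Q) (x : EuclideanSpace ℝ (Fin m)) : 0 ≤ supportFun Q x := by
  simpa using hQ.inner_le x hQ.zero_mem

theorem IsConvexBodyO.supportFun_add_le {m : ℕ} {Q : Set (EuclideanSpace ℝ (Fin m))}
    (hQ : IsConvexBodyO Q) (x x' : EuclideanSpace ℝ (Fin m)) :
    supportFun Q (x + x') ≤ supportFun Q x + supportFun Q x' := by
  refine csSup_le (Set.Nonempty.image _ ⟨0, hQ.zero_mem⟩) ?_
  rintro _ ⟨y, hy, rfl⟩
  simp only [inner_add_left]
  exact add_le_add (hQ.inner_le x hy) (hQ.inner_le x' hy)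

theorem supportFun_smul_arg {m : ℕ} (Q : Set (EuclideanSpace ℝ (Fin m)))
    {c : ℝ} (hc : 0 ≤ c) (x : EuclideanSpace ℝ (Fin m)) :
    supportFun Q (c • x) = c * supportFun Q x := by
  unfold supportFun
  rw [← smul_eq_mul, ← Real.sSup_smul_of_nonneg hc, ← Set.image_smul, Set.image_image]
  simp [real_inner_smul_left]

theorem lpSupport_smul {m : ℕ} {p s t : ℝ} (hp : 1 ≤ p) (hs : 0 ≤ s) (ht : 0 ≤ t)
    {Q₁ Q₂ : Set (EuclideanSpace ℝ (Fin m))} (h₁ : IsConvexBodyO Q₁) (h₂ : IsConvexBodyO Q₂)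
    {c : ℝ} (hc : 0 ≤ c) (x : EuclideanSpace ℝ (Fin m)) :
    lpSupport p s Q₁ t Q₂ (c • x) = c * lpSupport p s Q₁ t Q₂ x := by
  have hp0 : p ≠ 0 := by positivity
  have a₁ := h₁.supportFun_nonneg x
  have a₂ := h₂.supportFun_nonneg x
  unfold lpSupport
  rw [supportFun_smul_arg _ hc, supportFun_smul_arg _ hc, Real.mul_rpow hc a₁,
    Real.mul_rpow hc a₂,
    show s * (c ^ p * supportFun Q₁ x ^ p) + t * (c ^ p * supportFun Q₂ x ^ p)
      = c ^ p * (s * supportFun Q₁ x ^ p + t * supportFun Q₂ x ^ p) by ring,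
    Real.mul_rpow (by positivity) (by positivity), ← Real.rpow_mul hc,
    mul_one_div_cancel hp0, Real.rpow_one]

theorem lpSupport_add_le {m : ℕ} {p s t : ℝ} (hp : 1 ≤ p) (hs : 0 ≤ s) (ht : 0 ≤ t)
    {Q₁ Q₂ : Set (EuclideanSpace ℝ (Fin m))} (h₁ : IsConvexBodyO Q₁) (h₂ : IsConvexBodyO Q₂)
    (x x' : EuclideanSpace ℝ (Fin m)) :
    lpSupport p s Q₁ t Q₂ (x + x') ≤ lpSupport p s Q₁ t Q₂ x + lpSupport p s Q₁ t Q₂ x' := by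
  have hp0 : 0 < p := by positivity
  have a₁ := h₁.supportFun_nonneg x
  have a₂ := h₂.supportFun_nonneg x
  have b₁ := h₁.supportFun_nonneg x'
  have b₂ := h₂.supportFun_nonneg x'
  have key : ∀ (r : ℝ), 0 ≤ r → ∀ A : ℝ, 0 ≤ A → (r ^ (1 / p) * A) ^ p = r * A ^ p := by
    intro r hr A hA
    rw [Real.mul_rpow (by positivity) hA, ← Real.rpow_mul hr, one_div_mul_cancel hp0.ne',
      Real.rpow_one]
  have hM := Real.Lp_add_le_of_nonneg (s := (Finset.univ : Finset (Fin 2))) hp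
    (f := ![s ^ (1 / p) * supportFun Q₁ x, t ^ (1 / p) * supportFun Q₂ x])
    (g := ![s ^ (1 / p) * supportFun Q₁ x', t ^ (1 / p) * supportFun Q₂ x'])
    (by intro i _; fin_cases i <;> simp <;> positivity)
    (by intro i _; fin_cases i <;> simp <;> positivity)
  simp only [Fin.sum_univ_two, Matrix.cons_val_zero, Matrix.cons_val_one, ← mul_add] at hM
  rw [key s hs _ a₁, key t ht _ a₂, key s hs _ b₁, key t ht _ b₂, key s hs _ (by positivity),
    key t ht _ (by positivity)] at hM
  refine le_trans ?_ hM
  unfold lpSupport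
  have c₁ := h₁.supportFun_nonneg (x + x')
  have c₂ := h₂.supportFun_nonneg (x + x')
  have d₁ := h₁.supportFun_add_le x x'
  have d₂ := h₂.supportFun_add_le x x'
  gcongr

/-- The support function of the `L_p` combination is `(s h_{Q₁}^p + t h_{Q₂}^p)^{1/p}`. -/
theorem supportFun_lpSum {m : ℕ} {p s t : ℝ} (hp : 1 ≤ p) (hs : 0 ≤ s) (ht : 0 ≤ t)
    {Q₁ Q₂ : Set (EuclideanSpace ℝ (Fin m))} (h₁ : IsConvexBodyO Q₁) (h₂ : IsConvexBodyO Q₂)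
    (x : EuclideanSpace ℝ (Fin m)) :
    supportFun (lpSum p s Q₁ t Q₂) x = lpSupport p s Q₁ t Q₂ x := by
  have hN0 : ∀ x, 0 ≤ lpSupport p s Q₁ t Q₂ x := fun x => by
    have a₁ := h₁.supportFun_nonneg x
    have a₂ := h₂.supportFun_nonneg x
    unfold lpSupport; positivity
  have h0 : lpSupport p s Q₁ t Q₂ 0 = 0 := by
    simpa using lpSupport_smul hp hs ht h₁ h₂ le_rfl (0 : EuclideanSpace ℝ (Fin m))
  obtain ⟨y, hy, hxy⟩ : ∃ y ∈ lpSum p s Q₁ t Q₂, inner ℝ x y = lpSupport p s Q₁ t Q₂ x := by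
    by_cases hx : x = 0
    · subst hx
      exact ⟨0, fun z => by simpa using hN0 z, by simp [h0]⟩
    · obtain ⟨g, hg₁, hg₂⟩ := exists_extension_of_le_sublinear
        (LinearPMap.mkSpanSingleton x (lpSupport p s Q₁ t Q₂ x) hx) (lpSupport p s Q₁ t Q₂)
        (fun c hc z => lpSupport_smul hp hs ht h₁ h₂ hc.le z)
        (fun z z' => lpSupport_add_le hp hs ht h₁ h₂ z z') (by
          rintro ⟨z, hz⟩
          obtain ⟨c, rfl⟩ := Submodule.mem_span_singleton.1 hz
          refine (LinearPMap.mkSpanSingleton'_apply _ _ _ _ _).trans_le ?_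
          simp only [RingHom.id_apply, smul_eq_mul]
          rcases le_total 0 c with hc | hc
          · exact (lpSupport_smul hp hs ht h₁ h₂ hc x).ge
          · exact (mul_nonpos_of_nonpos_of_nonneg hc (hN0 x)).trans (hN0 _))
      refine ⟨(InnerProductSpace.toDual ℝ _).symm (LinearMap.toContinuousLinearMap g), ?_, ?_⟩
      · intro z
        rw [real_inner_comm, InnerProductSpace.toDual_symm_apply]
        exact hg₂ z
      · rw [real_inner_comm, InnerProductSpace.toDual_symm_apply]
        have := hg₁ ⟨x, Submodule.mem_span_singleton_self x⟩
        have e := LinearPMap.mkSpanSingleton_apply (σ := RingHom.id ℝ) ℝ ℝ hx (lpSupport p s Q₁ t Q₂ x)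
        exact this.trans e
  refine le_antisymm (csSup_le ⟨_, y, hy, rfl⟩ ?_) ?_
  · rintro _ ⟨z, hz, rfl⟩
    exact hz x
  · rw [← hxy]
    refine le_csSup ⟨lpSupport p s Q₁ t Q₂ x, ?_⟩ ⟨y, hy, rfl⟩
    rintro _ ⟨z, hz, rfl⟩
    exact hz x

/-- The defining identity `h^p = s h_{Q₁}^p + t h_{Q₂}^p` of the `L_p` combination. -/
theorem supportFun_lpSum_rpow {m : ℕ} {p s t : ℝ} (hp : 1 ≤ p) (hs : 0 ≤ s) (ht : 0 ≤ t)
    {Q₁ Q₂ : Set (EuclideanSpace ℝ (Fin m))} (h₁ : IsConvexBodyO Q₁) (h₂ : IsConvexBodyO Q₂)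
    (x : EuclideanSpace ℝ (Fin m)) :
    supportFun (lpSum p s Q₁ t Q₂) x ^ p = s * supportFun Q₁ x ^ p + t * supportFun Q₂ x ^ p := by
  have a₁ := h₁.supportFun_nonneg x
  have a₂ := h₂.supportFun_nonneg x
  rw [supportFun_lpSum hp hs ht h₁ h₂, lpSupport, ← Real.rpow_mul (by positivity),
    one_div_mul_cancel (by positivity), Real.rpow_one]

/-- An `L_p` combination, with weights not both zero, of convex bodies containing the origin is a
convex body containing the origin. -/
theorem isConvexBodyO_lpSum {m : ℕ} {p s t : ℝ} (hp : 1 ≤ p) (hs : 0 ≤ s) (ht : 0 ≤ t)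
    (hst : 0 < s + t) {Q₁ Q₂ : Set (EuclideanSpace ℝ (Fin m))} (h₁ : IsConvexBodyO Q₁)
    (h₂ : IsConvexBodyO Q₂) : IsConvexBodyO (lpSum p s Q₁ t Q₂) := by
  have hp0 : 0 < p := by positivity
  have hEq : lpSum p s Q₁ t Q₂ =
      ⋂ x, {y | inner ℝ x y ≤ lpSupport p s Q₁ t Q₂ x} := by
    ext y; simp [lpSum]
  have hsub : ∀ (r : ℝ), 0 ≤ r → ∀ Q : Set (EuclideanSpace ℝ (Fin m)), IsConvexBodyO Q →
      (∀ x, r * supportFun Q x ^ p ≤ s * supportFun Q₁ x ^ p + t * supportFun Q₂ x ^ p) →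
      r ^ (1 / p) • Q ⊆ lpSum p s Q₁ t Q₂ := by
    rintro r hr Q hQ hle _ ⟨y, hy, rfl⟩ x
    have a := hQ.supportFun_nonneg x
    have e : r ^ (1 / p) * supportFun Q x = (r * supportFun Q x ^ p) ^ (1 / p) := by
      rw [Real.mul_rpow hr (by positivity), ← Real.rpow_mul a, mul_one_div_cancel hp0.ne',
        Real.rpow_one]
    simp only [real_inner_smul_right]
    calc r ^ (1 / p) * inner ℝ x y ≤ r ^ (1 / p) * supportFun Q x := by
          have := hQ.inner_le x hy; gcongr
      _ ≤ _ := by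
          rw [e]; unfold lpSupport
          exact Real.rpow_le_rpow (by positivity) (hle x) (by positivity)
  have hint : ∀ r : ℝ, 0 < r → ∀ Q : Set (EuclideanSpace ℝ (Fin m)), IsConvexBodyO Q →
      r ^ (1 / p) • Q ⊆ lpSum p s Q₁ t Q₂ → (interior (lpSum p s Q₁ t Q₂)).Nonempty := by
    intro r hr Q hQ h
    have hr' : r ^ (1 / p) ≠ 0 := by positivity
    refine Set.Nonempty.mono (interior_mono h) ?_
    rw [interior_smul₀ hr']
    exact hQ.interior_nonempty.smul_set
  refine ⟨?_, ?_, ?_, ?_⟩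
  · rw [hEq]
    refine convex_iInter fun x => ?_
    exact convex_halfSpace_le (innerₛₗ ℝ x).isLinear _
  · have hcl : IsClosed (lpSum p s Q₁ t Q₂) := by
      rw [hEq]
      exact isClosed_iInter fun x => isClosed_le (by fun_prop) continuous_const
    refine Metric.isCompact_of_isClosed_isBounded hcl ?_
    have hbd : ∀ Q : Set (EuclideanSpace ℝ (Fin m)), IsConvexBodyO Q →
        ∃ R, ∀ x, ‖x‖ ≤ 1 → supportFun Q x ≤ R := by
      intro Q hQ
      obtain ⟨R, hR⟩ := hQ.isCompact.isBounded.exists_norm_le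
      refine ⟨R, fun x hx => csSup_le (Set.Nonempty.image _ ⟨0, hQ.zero_mem⟩) ?_⟩
      rintro _ ⟨y, hy, rfl⟩
      have h := hR y hy
      calc inner ℝ x y ≤ ‖x‖ * ‖y‖ := real_inner_le_norm _ _
        _ ≤ 1 * R := by gcongr
        _ = R := one_mul R
    obtain ⟨R₁, hR₁⟩ := hbd Q₁ h₁
    obtain ⟨R₂, hR₂⟩ := hbd Q₂ h₂
    refine isBounded_iff_forall_norm_le.2 ⟨(s * R₁ ^ p + t * R₂ ^ p) ^ (1 / p), fun y hy => ?_⟩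
    have hn : ‖‖y‖⁻¹ • y‖ ≤ 1 := by
      rw [norm_smul, norm_inv, norm_norm]; exact inv_mul_le_one
    have h := hy (‖y‖⁻¹ • y)
    have e : inner ℝ (‖y‖⁻¹ • y) y = ‖y‖ := by
      rw [real_inner_smul_left, real_inner_self_eq_norm_sq]
      by_cases h0 : ‖y‖ = 0
      · simp [h0]
      · field_simp
    rw [e] at h
    refine h.trans ?_
    unfold lpSupport
    have a₁ := h₁.supportFun_nonneg (‖y‖⁻¹ • y)
    have a₂ := h₂.supportFun_nonneg (‖y‖⁻¹ • y)
    have c₁ := hR₁ _ hn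
    have c₂ := hR₂ _ hn
    gcongr
  · rcases hs.lt_or_eq with h | h
    · refine hint s h Q₁ h₁ (hsub s hs Q₁ h₁ fun x => ?_)
      have a₂ := h₂.supportFun_nonneg x
      have : 0 ≤ t * supportFun Q₂ x ^ p := by positivity
      linarith
    · refine hint t (by linarith) Q₂ h₂ (hsub t ht Q₂ h₂ fun x => ?_)
      have a₁ := h₁.supportFun_nonneg x
      have : 0 ≤ s * supportFun Q₁ x ^ p := by positivity
      linarith
  · intro x
    have a₁ := h₁.supportFun_nonneg x
    have a₂ := h₂.supportFun_nonneg x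
    rw [inner_zero_right]
    unfold lpSupport
    positivity

end lpSumFacts

/-! ### Lipschitz star bodies -/

/-- The radial function `ρ_L(x) = sup {r ≥ 0 : r x ∈ L}`, of interest for `x ≠ 0`. -/
noncomputable def radialFun {n : ℕ} (L : Set (EuclideanSpace ℝ (Fin n)))
    (x : EuclideanSpace ℝ (Fin n)) : ℝ :=
  sSup {r : ℝ | 0 ≤ r ∧ r • x ∈ L}

/-- The boundary of `L` is Lipschitz: near each boundary point, after a rotation of the
coordinates, `L` is the region below the graph of a Lipschitz function and the boundary of `L` is
that graph. The `n`-th coordinate direction after rotation is the unit vector `e`, the other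
coordinates of `x` are recorded by the orthogonal projection `x - ⟪e, x⟫ e` of `x` to the
hyperplane perpendicular to `e`, and `g` is only evaluated on that hyperplane. -/
def HasLipschitzBoundary {n : ℕ} (L : Set (EuclideanSpace ℝ (Fin n))) : Prop :=
  ∀ z ∈ frontier L, ∃ e : EuclideanSpace ℝ (Fin n), ‖e‖ = 1 ∧
    ∃ (C : NNReal) (g : EuclideanSpace ℝ (Fin n) → ℝ), LipschitzWith C g ∧
      ∃ U ∈ 𝓝 z, ∀ x ∈ U,
        (x ∈ interior L ↔ inner ℝ e x < g (x - inner ℝ e x • e)) ∧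
        (x ∈ frontier L ↔ inner ℝ e x = g (x - inner ℝ e x • e))

/-- `L` is a Lipschitz star body about the origin: it is star-shaped about the origin, its radial
function is strictly positive and continuous on the unit sphere, and its boundary is Lipschitz.
(If `r x ∈ L` for arbitrarily large `r`, the real supremum `radialFun L x` is `0`, so positivity
includes boundedness in every direction.) -/
structure IsLipschitzStarBody {n : ℕ} (L : Set (EuclideanSpace ℝ (Fin n))) : Prop where
  starShaped : ∀ y ∈ L, ∀ r ∈ Icc (0 : ℝ) 1, r • y ∈ L
  radialFun_pos : ∀ u ∈ Metric.sphere (0 : EuclideanSpace ℝ (Fin n)) 1, 0 < radialFun L u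
  continuousOn_radialFun :
    ContinuousOn (radialFun L) (Metric.sphere (0 : EuclideanSpace ℝ (Fin n)) 1)
  lipschitzBoundary : HasLipschitzBoundary L

/-- `∂^* K`: the boundary points of `K` at which the gradient of the radial function exists. -/
def regularBoundary {n : ℕ} (K : Set (EuclideanSpace ℝ (Fin n))) :
    Set (EuclideanSpace ℝ (Fin n)) :=
  {z | z ∈ frontier K ∧ DifferentiableAt ℝ (radialFun K) z}

/-- The outer unit normal `ν_K(z)` at `z ∈ ∂^* K`. As `K` agrees, up to boundary points and away
from the origin, with the superlevel set `{ρ_K ≥ 1}` and its boundary is `{ρ_K = 1}`, this is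
`-∇ρ_K(z) / |∇ρ_K(z)|`; the gradient does not vanish since `∇ρ_K(z) ⬝ z = -ρ_K(z) = -1`. -/
noncomputable def outerNormal {n : ℕ} (K : Set (EuclideanSpace ℝ (Fin n)))
    (z : EuclideanSpace ℝ (Fin n)) : EuclideanSpace ℝ (Fin n) :=
  -(‖gradient (radialFun K) z‖⁻¹ • gradient (radialFun K) z)

/-! ### The projection body and the integral affine surface area

A matrix in `M_{n,m}(ℝ)` with the norm of the trace inner product is an element of
`EuclideanSpace ℝ (Fin n × Fin m)`. -/

/-- The matrix product `vᵀ x ∈ M_{1,m}(ℝ)` of `v ∈ M_{n,1}(ℝ)` and `x ∈ M_{n,m}(ℝ)`. -/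
noncomputable def rowMul {n m : ℕ} (v : EuclideanSpace ℝ (Fin n))
    (x : EuclideanSpace ℝ (Fin n × Fin m)) : EuclideanSpace ℝ (Fin m) :=
  WithLp.toLp 2 fun j => ∑ i, v i * x (i, j)

/-- The support function of the `(L_p, Q)`-projection body of `K`,
`h(x) = (∫_{∂^* K} h_Q(ν_K(z)ᵀ x)^p (z ⬝ ν_K(z))^{1-p} dℋ^{n-1}(z))^{1/p}`.
Here `μHE[n - 1]` is the Hausdorff measure in its Euclidean normalization. The integrand is
nonnegative, and the value is in `[0, ∞]`. -/
noncomputable def projBodySupport {n m : ℕ} (p : ℝ) (Q : Set (EuclideanSpace ℝ (Fin m)))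
    (K : Set (EuclideanSpace ℝ (Fin n))) (x : EuclideanSpace ℝ (Fin n × Fin m)) : ℝ≥0∞ :=
  (∫⁻ z in regularBoundary K,
    ENNReal.ofReal (supportFun Q (rowMul (outerNormal K z) x) ^ p *
      (inner ℝ z (outerNormal K z)) ^ (1 - p)) ∂μHE[n - 1]) ^ (1 / p)

/-- The `m`-th order `p`-integral affine surface area
`Φ_{p,Q}(K) = (∫_{S^{nm-1}} h(u)^{-nm} du)^{-p/(nm)}`, where `h` is the support function of the
`(L_p, Q)`-projection body of `K` and `du` is the surface measure of the unit sphere. -/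
noncomputable def intAffineSurfaceArea {n m : ℕ} (p : ℝ) (Q : Set (EuclideanSpace ℝ (Fin m)))
    (K : Set (EuclideanSpace ℝ (Fin n))) : ℝ≥0∞ :=
  (∫⁻ u : Metric.sphere (0 : EuclideanSpace ℝ (Fin n × Fin m)) 1,
    projBodySupport p Q K (u : EuclideanSpace ℝ (Fin n × Fin m)) ^ (-((n : ℝ) * m))
      ∂(volume : Measure (EuclideanSpace ℝ (Fin n × Fin m))).toSphere) ^ (-(p / ((n : ℝ) * m)))

/-! ### Hausdorff measure of nearly flat sets under linear maps -/

/-! On the boundary `ρ_K = 1`, and `ρ_K` is homogeneous of degree `-1`. Euler's identity therefore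
gives `z ⬝ g = -1` for `g = ∇ρ_K(z)`, so `z ⬝ ν = 1/|g|`, and the `p`-th power of the support
function becomes `P_{Q,K}(x) = ∫ h_Q(-gᵀx)^p |g|⁻¹ dℋ^{n-1}` (`projBodySupport_eq`). Thus
`Φ_{p,Q}(K)` is the mean of exponent `-nm/p` of `P_{Q,K}` over the sphere
(`intAffineSurfaceArea_eq`).

In this form `Q` enters only through `h_Q^p`. Scaling `Q` by `b` multiplies `P` by `b^p`. Passing to
`-Q` replaces `x` by `-x`. The `L_p` sum turns into a convex combination of the `P`'s, so concavity
is the reverse Minkowski inequality for negative exponents (`ENNReal.add_lintegral_rpow_neg_le`).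

For a linear `A`, the gradient at `Az` of the radial function of `AK` is `A⁻ᵀg`, and `A` distorts
area on `∂K` by `|det A| |A⁻ᵀg| / |g|`. The norms cancel, leaving `P_{Q,AK}(Ax) = |det A|
P_{Q,K}(x)` (`projBodyIntegral_image`). On the sphere, integrals of functions homogeneous of degree
`-nm` are volumes, so composing with `x ↦ Ax`, of determinant `(det A)^m`, multiplies the mean by
`|det A|^{p/n}`. Comparing the two factors gives affine invariance, and `A = a·1` gives the
homogeneity in `K`.

The area formula is proved only as an inequality, by cutting the hypersurface into countably many
nearly flat pieces. Applying it to `A` and to `A⁻¹` yields equality. -/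

/-- The hypothesis forces `f` to factor through `g` on `s`, by a `c`-Lipschitz map on `g '' s`. -/
theorem euclideanHausdorffMeasure_image_le_of_dist_le {X Y Z : Type*} [Nonempty X]
    [MetricSpace Y] [MeasurableSpace Y] [BorelSpace Y]
    [MetricSpace Z] [MeasurableSpace Z] [BorelSpace Z] {f : X → Y} {g : X → Z} {s : Set X}
    {c : NNReal} (h : ∀ x ∈ s, ∀ y ∈ s, dist (f x) (f y) ≤ c * dist (g x) (g y)) (d : ℕ) :
    μHE[d] (f '' s) ≤ (c : ℝ≥0∞) ^ d * μHE[d] (g '' s) := by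
  have hinv : ∀ x ∈ s, f (Function.invFunOn g s (g x)) = f x := by
    intro x hx
    have h1 := Function.invFunOn_mem (f := g) (s := s) ⟨x, hx, rfl⟩
    have h2 := Function.invFunOn_eq (f := g) (s := s) ⟨x, hx, rfl⟩
    have h3 := h _ h1 _ hx
    rw [h2, dist_self, mul_zero] at h3
    exact dist_le_zero.1 h3
  have himg : f '' s = (fun z => f (Function.invFunOn g s z)) '' (g '' s) := by
    rw [image_image]
    exact image_congr fun x hx => (hinv x hx).symm
  have hlip : LipschitzOnWith c (fun z => f (Function.invFunOn g s z)) (g '' s) := by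
    refine LipschitzOnWith.of_dist_le_mul ?_
    rintro _ ⟨x, hx, rfl⟩ _ ⟨y, hy, rfl⟩
    simp only [hinv x hx, hinv y hy]
    exact h x hx y hy
  have key := hlip.hausdorffMeasure_image_le (d := d) (by positivity)
  rw [himg, Measure.euclideanHausdorffMeasure_def, Measure.euclideanHausdorffMeasure_def,
    Measure.smul_apply, Measure.smul_apply, mul_smul_comm]
  rw [ENNReal.rpow_natCast] at key
  gcongr

section LinearJacobian

variable {E : Type*} [NormedAddCommGroup E] [InnerProductSpace ℝ E]
  {d : ℕ}

theorem exists_orthonormalBasis_zero_eq [FiniteDimensional ℝ E] (hE : Module.finrank ℝ E = d + 1) {v : E}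
    (hv : ‖v‖ = 1) : ∃ b : OrthonormalBasis (Fin (d + 1)) ℝ E, b 0 = v := by
  have ho : Orthonormal ℝ (({0} : Set (Fin (d + 1))).domRestrict fun _ => v) := by
    rw [orthonormal_iff_ite]
    rintro ⟨i, rfl⟩ ⟨j, rfl⟩
    simp [hv]
  obtain ⟨b, hb⟩ := ho.exists_orthonormalBasis_extension_of_card_eq (by simpa using hE)
  exact ⟨b, hb 0 rfl⟩

/-- The coordinates other than the first one with respect to an orthonormal basis. -/
noncomputable def tailCoord (b : OrthonormalBasis (Fin (d + 1)) ℝ E) (x : E) :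
    EuclideanSpace ℝ (Fin d) :=
  WithLp.toLp 2 fun j => b.repr x j.succ

/-- The vector with first coordinate zero and given other coordinates. -/
noncomputable def ofTailCoord (b : OrthonormalBasis (Fin (d + 1)) ℝ E)
    (c : EuclideanSpace ℝ (Fin d)) : E :=
  b.repr.symm (WithLp.toLp 2 (Fin.cons 0 c.ofLp))

theorem ofTailCoord_tailCoord (b : OrthonormalBasis (Fin (d + 1)) ℝ E) (x : E) :
    ofTailCoord b (tailCoord b x) = x - inner ℝ (b 0) x • b 0 := by
  apply b.repr.injective
  ext i
  refine Fin.cases ?_ (fun j => ?_) i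
  · simp [ofTailCoord, b.repr_apply_apply]
  · simp [ofTailCoord, tailCoord, b.repr_apply_apply]

theorem isometry_ofTailCoord (b : OrthonormalBasis (Fin (d + 1)) ℝ E) :
    Isometry (ofTailCoord b) := by
  refine b.repr.symm.isometry.comp (Isometry.of_dist_eq fun x y => ?_)
  simp [EuclideanSpace.dist_eq, Fin.sum_univ_succ]

theorem dist_tailCoord_le (b : OrthonormalBasis (Fin (d + 1)) ℝ E) (x y : E) :
    dist (tailCoord b x) (tailCoord b y) ≤ dist x y := by
  rw [← b.repr.dist_map x y, EuclideanSpace.dist_eq, EuclideanSpace.dist_eq, Fin.sum_univ_succ]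
  refine Real.sqrt_le_sqrt (le_add_of_nonneg_left (by positivity))

/-- `A` maps the hyperplane orthogonal to `b 0` onto the one orthogonal to `w`. In orthonormal bases
starting with `b 0` and `w/‖w‖`, the first row of its matrix is `(1/‖w‖, 0, …, 0)`, so the remaining
block, which carries the area, has determinant `‖w‖ det A` up to sign. -/
theorem euclideanHausdorffMeasure_image_image_ofTailCoord [FiniteDimensional ℝ E]
    [MeasurableSpace E] [BorelSpace E]
    (hE : Module.finrank ℝ E = d + 1) (A : E ≃L[ℝ] E)
    (b : OrthonormalBasis (Fin (d + 1)) ℝ E) {w : E}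
    (hw : ∀ x, inner ℝ w (A x) = inner ℝ (b 0) x) (U : Set (EuclideanSpace ℝ (Fin d))) :
    μHE[d] (A '' (ofTailCoord b '' U)) =
      ENNReal.ofReal (|LinearMap.det (A : E →ₗ[ℝ] E)| * ‖w‖) * μHE[d] U := by
  have hw0 : w ≠ 0 := by
    rintro rfl
    have := hw (b 0)
    simp at this
  have hwn : 0 < ‖w‖ := norm_pos_iff.2 hw0
  obtain ⟨b', hb'⟩ := exists_orthonormalBasis_zero_eq (v := ‖w‖⁻¹ • w) hE
    (by rw [norm_smul]; simp [hwn.ne'])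
  set M : Matrix (Fin (d + 1)) (Fin (d + 1)) ℝ :=
    LinearMap.toMatrix b.toBasis b'.toBasis (A : E →ₗ[ℝ] E) with hM
  have hM0 : ∀ j, M 0 j = ‖w‖⁻¹ * inner ℝ (b 0) (b j) := by
    intro j
    rw [hM, LinearMap.toMatrix_apply]
    simp [b'.repr_apply_apply, hb', inner_smul_left, hw]
  have hM00 : M 0 0 = ‖w‖⁻¹ := by simp [hM0]
  have hM0s : ∀ j : Fin d, M 0 j.succ = 0 := fun j => by
    simp [hM0, b.inner_eq_zero (Fin.succ_ne_zero j).symm]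
  set N := M.submatrix Fin.succ Fin.succ with hN
  have hdetM : M.det = ‖w‖⁻¹ * N.det := by
    rw [Matrix.det_succ_row_zero, Fin.sum_univ_succ]
    simp [hM0s, hM00, hN]
  have hdetA : |M.det| = |LinearMap.det (A : E →ₗ[ℝ] E)| := by
    rw [← LinearMap.normDet_eq_abs_det, LinearMap.normDet_eq_norm_det_toMatrix _ b b',
      Real.norm_eq_abs]
  have hmap : ∀ c, A (ofTailCoord b c) = ofTailCoord b' (Matrix.toEuclideanLin N c) := by
    intro c
    apply b'.repr.injective
    have h := LinearMap.toMatrix_mulVec_repr b.toBasis b'.toBasis (A : E →ₗ[ℝ] E) (ofTailCoord b c)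
    ext i
    have hi := (congrFun h i).symm
    have hl : b'.toBasis.repr ((A : E →ₗ[ℝ] E) (ofTailCoord b c)) i
        = b'.repr (A (ofTailCoord b c)) i := by
      simp
    have hr : ∀ k, b.toBasis.repr (ofTailCoord b c) k = (Fin.cons 0 c.ofLp : Fin (d + 1) → ℝ) k :=
      fun k => by simp [ofTailCoord]
    rw [hl] at hi
    rw [hi, Matrix.mulVec, dotProduct, Fin.sum_univ_succ]
    simp only [hr, Fin.cons_zero, Fin.cons_succ, mul_zero, zero_add]
    refine Fin.cases ?_ (fun j => ?_) i
    · simp [ofTailCoord, ← hM, hM0s]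
    · simp [ofTailCoord, ← hM, hN, Matrix.toLpLin_apply, Matrix.mulVec, dotProduct]
  have himg : A '' (ofTailCoord b '' U) = ofTailCoord b' '' (Matrix.toEuclideanLin N '' U) := by
    rw [image_image, image_image]
    exact image_congr fun c _ => hmap c
  rw [himg, (isometry_ofTailCoord b').euclideanHausdorffMeasure_image,
    EuclideanSpace.euclideanHausdorffMeasure_eq_volume, Measure.addHaar_image_linearMap,
    LinearMap.det_toLpLin, ← hdetA, hdetM]
  congr 2
  rw [abs_mul, abs_inv, abs_norm]
  field_simp

/-- `T` is compared with its projection to the hyperplane orthogonal to `v`, which does not increase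
measure. Removing the `v`-component of a difference `u` changes `A u` by at most `‖A‖ ‖A⁻¹‖ ε ‖A
u‖`, so `hc` makes `c` a Lipschitz constant for undoing the projection after `A`. -/
theorem euclideanHausdorffMeasure_image_le_of_abs_inner_le [FiniteDimensional ℝ E]
    [MeasurableSpace E] [BorelSpace E]
    (hE : Module.finrank ℝ E = d + 1) (A : E ≃L[ℝ] E) {v w : E} (hv : ‖v‖ = 1)
    (hw : ∀ x, inner ℝ w (A x) = inner ℝ v x) {ε : ℝ} (c : NNReal)
    (hc : 1 ≤ c * (1 - ‖(A : E →L[ℝ] E)‖ * ‖(A.symm : E →L[ℝ] E)‖ * ε)) {T : Set E}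
    (hT : ∀ x ∈ T, ∀ y ∈ T, |inner ℝ v (x - y)| ≤ ε * ‖x - y‖) :
    μHE[d] (A '' T) ≤
      (c : ℝ≥0∞) ^ d * (ENNReal.ofReal (|LinearMap.det (A : E →ₗ[ℝ] E)| * ‖w‖) * μHE[d] T) := by
  obtain ⟨b, rfl⟩ := exists_orthonormalBasis_zero_eq hE hv
  have h1 : μHE[d] (A '' T) ≤
      (c : ℝ≥0∞) ^ d * μHE[d] ((fun x => A (ofTailCoord b (tailCoord b x))) '' T) := by
    refine euclideanHausdorffMeasure_image_le_of_dist_le (fun x hx y hy => ?_) d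
    rw [dist_eq_norm, dist_eq_norm, ← map_sub, ← map_sub, ofTailCoord_tailCoord,
      ofTailCoord_tailCoord]
    set u := x - y with hu
    have e : x - inner ℝ (b 0) x • b 0 - (y - inner ℝ (b 0) y • b 0)
        = u - inner ℝ (b 0) u • b 0 := by
      rw [hu, inner_sub_right, sub_smul]; abel
    rw [e, map_sub A u, map_smul]
    have k1 : ‖A u‖ ≤ ‖A u - inner ℝ (b 0) u • A (b 0)‖ + ‖inner ℝ (b 0) u • A (b 0)‖ := by
      simpa using norm_add_le (A u - inner ℝ (b 0) u • A (b 0)) (inner ℝ (b 0) u • A (b 0))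
    have k2 : ‖inner ℝ (b 0) u • A (b 0)‖ ≤
        ‖(A : E →L[ℝ] E)‖ * ‖(A.symm : E →L[ℝ] E)‖ * ε * ‖A u‖ := by
      rw [norm_smul, Real.norm_eq_abs]
      have a1 : ‖A (b 0)‖ ≤ ‖(A : E →L[ℝ] E)‖ := by
        simpa using (A : E →L[ℝ] E).le_opNorm (b 0)
      have a2 : ‖u‖ ≤ ‖(A.symm : E →L[ℝ] E)‖ * ‖A u‖ := by
        simpa using (A.symm : E →L[ℝ] E).le_opNorm (A u)
      have a3 := hT x hx y hy
      rw [← hu] at a3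
      rcases eq_or_ne u 0 with h0 | h0
      · simp [h0]
      have hε : 0 ≤ ε := by
        have := (abs_nonneg _).trans a3
        exact nonneg_of_mul_nonneg_left this (norm_pos_iff.2 h0)
      calc |inner ℝ (b 0) u| * ‖A (b 0)‖
          ≤ (ε * (‖(A.symm : E →L[ℝ] E)‖ * ‖A u‖)) * ‖(A : E →L[ℝ] E)‖ := by
            refine mul_le_mul (a3.trans ?_) a1 (norm_nonneg _) (by positivity)
            gcongr
        _ = _ := by ring
    have k3 : ‖A u‖ * 1 ≤ ‖A u‖ *
        (c * (1 - ‖(A : E →L[ℝ] E)‖ * ‖(A.symm : E →L[ℝ] E)‖ * ε)) := by gcongr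
    have k4 : (c : ℝ) * ‖A u‖ ≤ c * (‖A u - inner ℝ (b 0) u • A (b 0)‖ +
        ‖(A : E →L[ℝ] E)‖ * ‖(A.symm : E →L[ℝ] E)‖ * ε * ‖A u‖) :=
      mul_le_mul_of_nonneg_left (k1.trans (by gcongr)) c.2
    linarith
  have h2 : μHE[d] (tailCoord b '' T) ≤ μHE[d] T := by
    have := euclideanHausdorffMeasure_image_le_of_dist_le (f := tailCoord b) (g := id) (s := T)
      (c := 1) (fun x _ y _ => by simpa using dist_tailCoord_le b x y) d
    simpa using this
  refine h1.trans ?_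
  have e : (fun x => A (ofTailCoord b (tailCoord b x))) '' T
      = A '' (ofTailCoord b '' (tailCoord b '' T)) := by
    rw [image_image, image_image]
  rw [e, euclideanHausdorffMeasure_image_image_ofTailCoord hE A b hw]
  gcongr

end LinearJacobian

/-! ### Area distortion of a linear map along a hypersurface -/

section HypersurfaceChangeOfVariables

variable {E : Type*} [NormedAddCommGroup E] [InnerProductSpace ℝ E] [FiniteDimensional ℝ E]

theorem inner_adjoint_symm_apply (A : E ≃L[ℝ] E) (v x : E) :
    inner ℝ ((A.symm : E →L[ℝ] E).adjoint v) (A x) = inner ℝ v x := by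
  rw [ContinuousLinearMap.adjoint_inner_left]
  simp

/-- The area distortion of the linear map `A` on the hyperplane with unit normal `v`. -/
noncomputable def hyperplaneJacobian (A : E ≃L[ℝ] E) (v : E) : ℝ :=
  |LinearMap.det (A : E →ₗ[ℝ] E)| * ‖(A.symm : E →L[ℝ] E).adjoint v‖

/-- The pairing of `A⁻ᵀv'` with `Av'` is `1`, which bounds `‖A⁻ᵀv'‖` below by `1/‖A‖`. This turns
the additive error `‖A⁻ᵀ‖ ε` into a factor. -/
theorem hyperplaneJacobian_le_mul (A : E ≃L[ℝ] E) {v v' : E} (hv' : ‖v'‖ = 1) {ε c : ℝ}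
    (hvv : ‖v - v'‖ ≤ ε)
    (hc : ‖(A.symm : E →L[ℝ] E).adjoint‖ * ‖(A : E →L[ℝ] E)‖ * ε ≤ c - 1) :
    hyperplaneJacobian A v ≤ c * hyperplaneJacobian A v' := by
  set B := (A.symm : E →L[ℝ] E).adjoint
  have hε : 0 ≤ ε := (norm_nonneg _).trans hvv
  have h1 : 1 ≤ ‖B v'‖ * ‖(A : E →L[ℝ] E)‖ := by
    have e : inner ℝ (B v') (A v') = 1 := by
      rw [inner_adjoint_symm_apply, real_inner_self_eq_norm_sq, hv', one_pow]
    calc (1 : ℝ) = inner ℝ (B v') (A v') := e.symm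
      _ ≤ ‖B v'‖ * ‖A v'‖ := real_inner_le_norm _ _
      _ ≤ ‖B v'‖ * ‖(A : E →L[ℝ] E)‖ := by
          gcongr
          simpa [hv'] using (A : E →L[ℝ] E).le_opNorm v'
  have h2 : ‖B v‖ ≤ ‖B v'‖ + ‖B‖ * ε := by
    calc ‖B v‖ = ‖B v' + B (v - v')‖ := by simp
      _ ≤ ‖B v'‖ + ‖B (v - v')‖ := norm_add_le _ _
      _ ≤ ‖B v'‖ + ‖B‖ * ε := by
          gcongr
          exact (B.le_opNorm _).trans (by gcongr)
  have h3 : ‖B v‖ ≤ c * ‖B v'‖ := by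
    have h4 : ‖B‖ * ε * 1 ≤ ‖B‖ * ε * (‖B v'‖ * ‖(A : E →L[ℝ] E)‖) := by gcongr
    have h5 := mul_le_mul_of_nonneg_left hc (norm_nonneg (B v'))
    linarith
  unfold hyperplaneJacobian
  calc _ ≤ |LinearMap.det (A : E →ₗ[ℝ] E)| * (c * ‖B v'‖) := by gcongr
    _ = _ := by ring

variable [MeasurableSpace E] [BorelSpace E] {d : ℕ}

/-- `hd` says that `ν z` is normal to `S`: `ν z ⬝ (w - z) = o(‖w - z‖)` for `w ∈ S`. Flattening the
pieces costs `c ^ d`, and freezing the normal on each piece costs one more `c`. -/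
theorem euclideanHausdorffMeasure_image_le_of_norm_normal_sub_le
    (hE : Module.finrank ℝ E = d + 1) (A : E ≃L[ℝ] E) {S : Set E} (hS : MeasurableSet S)
    {ν : E → E} (hν : ∀ z ∈ S, ‖ν z‖ = 1)
    (hd : ∀ z ∈ S, HasFDerivWithinAt (fun _ => (0 : ℝ)) (innerSL ℝ (ν z)) S z)
    {ε c : NNReal} (hε : ε ≠ 0)
    (hc₁ : 1 ≤ (c : ℝ) * (1 - ‖(A : E →L[ℝ] E)‖ * ‖(A.symm : E →L[ℝ] E)‖ * ε))
    (hc₂ : ‖(A.symm : E →L[ℝ] E).adjoint‖ * ‖(A : E →L[ℝ] E)‖ * ε ≤ c - 1)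
    (hνε : ∀ z ∈ S, ∀ z' ∈ S, ‖ν z - ν z'‖ ≤ ε) :
    μHE[d] (A '' S) ≤ (c : ℝ≥0∞) ^ (d + 1) *
      ∫⁻ z in S, ENNReal.ofReal (hyperplaneJacobian A (ν z)) ∂μHE[d] := by
  rcases S.eq_empty_or_nonempty with rfl | hne
  · simp
  obtain ⟨t, L, hdisj, htm, hcov, happ, hL⟩ :=
    exists_partition_approximatesLinearOn_of_hasFDerivWithinAt (fun _ => (0 : ℝ)) S
      (fun z => innerSL ℝ (ν z)) hd (fun _ => ε) (fun _ => hε)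
  have hpiece : ∀ k, μHE[d] (A '' (S ∩ t k)) ≤ (c : ℝ≥0∞) ^ (d + 1) *
      ∫⁻ z in S ∩ t k, ENNReal.ofReal (hyperplaneJacobian A (ν z)) ∂μHE[d] := by
    intro k
    -- The point `y` lies in `S` but perhaps not in `t k`, so the bound on the variation of `ν` is
    -- needed on all of `S`.
    obtain ⟨y, hy, hLy⟩ := hL hne k
    have h1 := euclideanHausdorffMeasure_image_le_of_abs_inner_le hE A (hν y hy)
      (inner_adjoint_symm_apply A (ν y)) c hc₁ (T := S ∩ t k) (by
        intro x hx x' hx'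
        have := happ k x hx x' hx'
        simpa [hLy] using this)
    refine h1.trans ?_
    rw [pow_succ, mul_assoc]
    refine mul_le_mul_right ?_ _
    calc _ = ∫⁻ _ in S ∩ t k, ENNReal.ofReal (hyperplaneJacobian A (ν y)) ∂μHE[d] := by
          rw [setLIntegral_const]; rfl
      _ ≤ ∫⁻ z in S ∩ t k, c * ENNReal.ofReal (hyperplaneJacobian A (ν z)) ∂μHE[d] := by
          refine setLIntegral_mono' (hS.inter (htm k)) fun z hz => ?_
          rw [← ENNReal.ofReal_coe_nnreal (p := c), ← ENNReal.ofReal_mul (NNReal.coe_nonneg c)]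
          exact ENNReal.ofReal_le_ofReal
            (hyperplaneJacobian_le_mul A (hν z hz.1) (hνε y hy z hz.1) hc₂)
      _ = _ := lintegral_const_mul' _ _ ENNReal.coe_ne_top
  have hSU : S = ⋃ k, S ∩ t k := by
    rw [← inter_iUnion, inter_eq_left.2 hcov]
  calc μHE[d] (A '' S) = μHE[d] (⋃ k, A '' (S ∩ t k)) := by rw [← image_iUnion, ← hSU]
    _ ≤ ∑' k, μHE[d] (A '' (S ∩ t k)) := measure_iUnion_le _
    _ ≤ ∑' k, (c : ℝ≥0∞) ^ (d + 1) *
        ∫⁻ z in S ∩ t k, ENNReal.ofReal (hyperplaneJacobian A (ν z)) ∂μHE[d] :=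
        ENNReal.tsum_le_tsum hpiece
    _ = _ := by
        rw [ENNReal.tsum_mul_left, ← lintegral_iUnion (fun k => hS.inter (htm k))
          (fun i j hij => (hdisj hij).mono inter_subset_right inter_subset_right), ← hSU]

theorem euclideanHausdorffMeasure_image_le_lintegral
    (hE : Module.finrank ℝ E = d + 1) (A : E ≃L[ℝ] E) {S : Set E} (hS : MeasurableSet S)
    {ν : E → E} (hνm : Measurable ν) (hν : ∀ z ∈ S, ‖ν z‖ = 1)
    (hd : ∀ z ∈ S, HasFDerivWithinAt (fun _ => (0 : ℝ)) (innerSL ℝ (ν z)) S z) :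
    μHE[d] (A '' S) ≤ ∫⁻ z in S, ENNReal.ofReal (hyperplaneJacobian A (ν z)) ∂μHE[d] := by
  have key : ∀ c : NNReal, 1 < c → μHE[d] (A '' S) ≤ (c : ℝ≥0∞) ^ (d + 1) *
      ∫⁻ z in S, ENNReal.ofReal (hyperplaneJacobian A (ν z)) ∂μHE[d] := by
    intro c hc
    have hc' : (1 : ℝ) < c := by exact_mod_cast hc
    obtain ⟨ε, hε, hc₁, hc₂⟩ : ∃ ε : NNReal, 0 < ε ∧
        1 ≤ (c : ℝ) * (1 - ‖(A : E →L[ℝ] E)‖ * ‖(A.symm : E →L[ℝ] E)‖ * ε) ∧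
        ‖(A.symm : E →L[ℝ] E).adjoint‖ * ‖(A : E →L[ℝ] E)‖ * ε ≤ c - 1 := by
      have t1 : Filter.Tendsto (fun ε : NNReal =>
          (c : ℝ) * (1 - ‖(A : E →L[ℝ] E)‖ * ‖(A.symm : E →L[ℝ] E)‖ * ε)) (𝓝[>] 0) (𝓝 c) := by
        have : Continuous fun ε : NNReal =>
          (c : ℝ) * (1 - ‖(A : E →L[ℝ] E)‖ * ‖(A.symm : E →L[ℝ] E)‖ * ε) := by fun_prop
        exact Filter.Tendsto.mono_left (by simpa using this.tendsto 0) nhdsWithin_le_nhds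
      have t2 : Filter.Tendsto (fun ε : NNReal =>
          ‖(A.symm : E →L[ℝ] E).adjoint‖ * ‖(A : E →L[ℝ] E)‖ * ε) (𝓝[>] 0) (𝓝 0) := by
        have : Continuous fun ε : NNReal =>
          ‖(A.symm : E →L[ℝ] E).adjoint‖ * ‖(A : E →L[ℝ] E)‖ * (ε : ℝ) := by fun_prop
        exact Filter.Tendsto.mono_left (by simpa using this.tendsto 0) nhdsWithin_le_nhds
      obtain ⟨ε, h1, h2, h3⟩ := ((t1.eventually (lt_mem_nhds hc')).and
        ((t2.eventually (gt_mem_nhds (sub_pos.2 hc'))).and self_mem_nhdsWithin)).exists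
      exact ⟨ε, h3, h1.le, h2.le⟩
    -- Cells are preimages under `ν` of disjointed balls of radius `ε / 2`, so `ν` varies by less
    -- than `ε` on each.
    set q := TopologicalSpace.denseSeq E
    set cell : ℕ → Set E := fun j => S ∩ ν ⁻¹' (disjointed (fun j => Metric.ball (q j) (ε / 2)) j)
      with hcell
    have hcm : ∀ j, MeasurableSet (cell j) := fun j =>
      hS.inter (hνm (MeasurableSet.disjointed (fun _ => Metric.isOpen_ball.measurableSet) j))
    have hSU : S = ⋃ j, cell j := by
      rw [hcell, ← inter_iUnion, ← preimage_iUnion, iUnion_disjointed, eq_comm, inter_eq_left]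
      intro z _
      obtain ⟨j, hj⟩ := (TopologicalSpace.denseRange_denseSeq E).exists_dist_lt (ν z)
        (ε := (ε : ℝ) / 2) (by positivity)
      exact mem_iUnion.2 ⟨j, hj⟩
    have hpiece : ∀ j, μHE[d] (A '' cell j) ≤ (c : ℝ≥0∞) ^ (d + 1) *
        ∫⁻ z in cell j, ENNReal.ofReal (hyperplaneJacobian A (ν z)) ∂μHE[d] := by
      intro j
      refine euclideanHausdorffMeasure_image_le_of_norm_normal_sub_le hE A (hcm j)
        (fun z hz => hν z hz.1) (fun z hz => (hd z hz.1).mono inter_subset_left) hε.ne' hc₁ hc₂ ?_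
      intro z hz z' hz'
      have h1 := Metric.mem_ball.1 (disjointed_subset (fun j => Metric.ball (q j) ((ε : ℝ) / 2)) j hz.2)
      have h2 := Metric.mem_ball.1 (disjointed_subset (fun j => Metric.ball (q j) ((ε : ℝ) / 2)) j hz'.2)
      rw [← dist_eq_norm]
      linarith [dist_triangle_right (ν z) (ν z') (q j)]
    calc μHE[d] (A '' S) = μHE[d] (⋃ j, A '' cell j) := by rw [← image_iUnion, ← hSU]
      _ ≤ ∑' j, μHE[d] (A '' cell j) := measure_iUnion_le _
      _ ≤ ∑' j, (c : ℝ≥0∞) ^ (d + 1) *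
          ∫⁻ z in cell j, ENNReal.ofReal (hyperplaneJacobian A (ν z)) ∂μHE[d] :=
          ENNReal.tsum_le_tsum hpiece
      _ = _ := by
          rw [ENNReal.tsum_mul_left, ← lintegral_iUnion hcm (fun i j hij =>
            (((disjoint_disjointed _) hij).preimage ν).mono inter_subset_right
              inter_subset_right), ← hSU]
  set I := ∫⁻ z in S, ENNReal.ofReal (hyperplaneJacobian A (ν z)) ∂μHE[d]
  have hlim : Filter.Tendsto (fun c : NNReal => (c : ℝ≥0∞) ^ (d + 1) * I) (𝓝[>] 1) (𝓝 I) := by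
    have h1 : Filter.Tendsto (fun c : NNReal => (c : ℝ≥0∞) ^ (d + 1)) (𝓝[>] 1) (𝓝 1) := by
      have : Continuous fun c : NNReal => (c : ℝ≥0∞) ^ (d + 1) :=
        (ENNReal.continuous_pow _).comp ENNReal.continuous_coe
      exact Filter.Tendsto.mono_left (by simpa using this.tendsto 1) nhdsWithin_le_nhds
    simpa using ENNReal.Tendsto.mul_const h1 (Or.inl one_ne_zero)
  exact ge_of_tendsto hlim (Filter.eventually_of_mem self_mem_nhdsWithin key)

/-- Change of variables along a hypersurface: if `ν z` is normal to `S` at each `z ∈ S`, then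
integrating over `A '' S` is dominated by integrating over `S` against the area distortion. -/
theorem lintegral_image_le_lintegral_hyperplaneJacobian
    (hE : Module.finrank ℝ E = d + 1) (A : E ≃L[ℝ] E) {S : Set E} (hS : MeasurableSet S)
    {ν : E → E} (hνm : Measurable ν) (hν : ∀ z ∈ S, ‖ν z‖ = 1)
    (hd : ∀ z ∈ S, HasFDerivWithinAt (fun _ => (0 : ℝ)) (innerSL ℝ (ν z)) S z)
    (F : E → ℝ≥0∞) :
    ∫⁻ w in A '' S, F w ∂μHE[d] ≤
      ∫⁻ z in S, ENNReal.ofReal (hyperplaneJacobian A (ν z)) * F (A z) ∂μHE[d] := by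
  have hJm : Measurable fun z => ENNReal.ofReal (hyperplaneJacobian A (ν z)) := by
    unfold hyperplaneJacobian
    fun_prop
  have hAe : MeasurableEmbedding A := A.toHomeomorph.measurableEmbedding
  -- Stated as a comparison of measures, the bound on sets integrates against any `F`, measurable or
  -- not.
  have hle : (μHE[d].restrict (A '' S)) ≤
      ((μHE[d].restrict S).withDensity
        fun z => ENNReal.ofReal (hyperplaneJacobian A (ν z))).map A := by
    refine Measure.le_iff.2 fun T hT => ?_
    rw [Measure.restrict_apply hT, hAe.map_apply,
      withDensity_apply _ (hAe.measurable hT), Measure.restrict_restrict (hAe.measurable hT),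
      inter_comm T, ← image_inter_preimage, inter_comm]
    exact euclideanHausdorffMeasure_image_le_lintegral hE A ((hAe.measurable hT).inter hS) hνm
      (fun z hz => hν z hz.2) (fun z hz => (hd z hz.2).mono inter_subset_right)
  refine (lintegral_mono' hle le_rfl).trans_eq ?_
  rw [hAe.lintegral_map, lintegral_withDensity_eq_lintegral_mul_non_measurable _ hJm
    (Filter.Eventually.of_forall fun _ => ENNReal.ofReal_lt_top)]
  rfl

end HypersurfaceChangeOfVariables

/-! ### Sphere integrals of homogeneous functions -/

section SphereIntegral

variable {E : Type*} [NormedAddCommGroup E] [NormedSpace ℝ E] [FiniteDimensional ℝ E]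
  [MeasurableSpace E] [BorelSpace E] [Nontrivial E] (μ : Measure E) [μ.IsAddHaarMeasure]

/-- This is `(k + 1) ∫₀^{1/c} r^k dr`, including `c = 0` (the whole ray) and `c = ∞` (the empty
set). -/
theorem volumeIoiPow_mul_lt_one {k : ℕ} (c : ℝ≥0∞) :
    ((k : ℝ≥0∞) + 1) * Measure.volumeIoiPow k {r : Ioi (0 : ℝ) | ENNReal.ofReal r * c < 1} =
      c ^ (-((k : ℝ) + 1)) := by
  have hk : -((k : ℝ) + 1) < 0 := by linarith [(k.cast_nonneg : (0 : ℝ) ≤ k)]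
  have hk1 : ((k : ℝ≥0∞) + 1) = ENNReal.ofReal (k + 1) := by
    rw [ENNReal.ofReal_add (by positivity) zero_le_one]; simp
  rcases eq_or_ne c 0 with rfl | hc0
  · rw [ENNReal.zero_rpow_of_neg hk]
    have : (∀ n : ℕ, (n : ℝ≥0∞) ≤
        ((k : ℝ≥0∞) + 1) * Measure.volumeIoiPow k {r : Ioi (0 : ℝ) | ENNReal.ofReal r * 0 < 1}) := by
      intro n
      have hpos : (0 : ℝ) < n + 1 := by positivity
      have h1 : Measure.volumeIoiPow k (Iio ⟨(n : ℝ) + 1, hpos⟩) ≤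
          Measure.volumeIoiPow k {r : Ioi (0 : ℝ) | ENNReal.ofReal r * 0 < 1} :=
        measure_mono fun r _ => by simp
      refine le_trans ?_ (mul_le_mul_right h1 _)
      rw [Measure.volumeIoiPow_apply_Iio, hk1, ← ENNReal.ofReal_mul (by positivity),
        ← ENNReal.ofReal_natCast]
      refine ENNReal.ofReal_le_ofReal ?_
      have : ((n : ℝ) + 1) ≤ ((n : ℝ) + 1) ^ (k + 1) := le_self_pow₀ (by simp) (by simp)
      simp only
      field_simp
      linarith
    exact ENNReal.eq_top_of_forall_nnreal_le fun x => by
      obtain ⟨n, hn⟩ := exists_nat_ge x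
      exact le_trans (by exact_mod_cast hn) (this n)
  rcases eq_or_ne c ⊤ with rfl | hct
  · rw [ENNReal.top_rpow_of_neg hk]
    have : {r : Ioi (0 : ℝ) | ENNReal.ofReal r * ⊤ < 1} = ∅ := by
      ext r
      have : ENNReal.ofReal r ≠ 0 := (ENNReal.ofReal_pos.2 r.2).ne'
      simp [ENNReal.mul_top this]
    simp [this]
  · lift c to NNReal using hct
    have hc : 0 < (c : ℝ) := by
      have : c ≠ 0 := by simpa using hc0
      positivity
    have hset : {r : Ioi (0 : ℝ) | ENNReal.ofReal r * c < 1} = Iio ⟨(c : ℝ)⁻¹, inv_pos.2 hc⟩ := by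
      ext r
      have hr : (0 : ℝ) < r := r.2
      rw [mem_ofPred_eq, mem_Iio, ← Subtype.coe_lt_coe, ← ENNReal.ofReal_coe_nnreal,
        ← ENNReal.ofReal_mul hr.le, ENNReal.ofReal_lt_one, lt_inv_comm₀ hr hc]
      rw [← one_div, lt_div_iff₀ hr, mul_comm]
    rw [hset, Measure.volumeIoiPow_apply_Iio, hk1, ← ENNReal.ofReal_mul (by positivity),
      ← ENNReal.ofReal_coe_nnreal, ENNReal.ofReal_rpow_of_pos hc, Real.rpow_neg hc.le]
    congr 1
    have : (c : ℝ) ^ ((k : ℝ) + 1) = c ^ (k + 1) := by exact_mod_cast Real.rpow_natCast c (k + 1)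
    rw [this, inv_pow]
    field_simp

/-- Polar coordinates: the ray through `u` meets `{h < 1}` where `r h(u) < 1`. A volume, unlike a
sphere integral, transforms simply under linear maps. -/
theorem lintegral_toSphere_rpow_neg_finrank {h : E → ℝ≥0∞} (hm : Measurable h)
    (hh : ∀ r : ℝ, 0 < r → ∀ x, h (r • x) = ENNReal.ofReal r * h x) :
    ∫⁻ u : Metric.sphere (0 : E) 1, h u ^ (-(Module.finrank ℝ E : ℝ)) ∂μ.toSphere =
      Module.finrank ℝ E * μ {x | h x < 1} := by
  set k := Module.finrank ℝ E - 1 with hk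
  have hk1 : Module.finrank ℝ E = k + 1 := by
    have : 0 < Module.finrank ℝ E := Module.finrank_pos
    omega
  set T : Set (Metric.sphere (0 : E) 1 × Ioi (0 : ℝ)) :=
    {q | h ((q.2 : ℝ) • (q.1 : E)) < 1} with hT
  have hTm : MeasurableSet T := by
    refine measurableSet_lt (hm.comp ?_) measurable_const
    fun_prop
  have h1 : μ {x | h x < 1} = (μ.toSphere.prod (Measure.volumeIoiPow k)) T := by
    rw [← (μ.measurePreserving_homeomorphUnitSphereProd).measure_preimage hTm.nullMeasurableSet]
    have e : homeomorphUnitSphereProd E ⁻¹' T = (↑) ⁻¹' {x | h x < 1} := by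
      ext x
      have hx : ‖(x : E)‖ ≠ 0 := norm_ne_zero_iff.2 x.2
      simp [hT, smul_smul, hx]
    rw [e, comap_subtype_coe_apply (measurableSet_singleton _).compl, Subtype.image_preimage_coe,
      inter_comm, ← sdiff_eq, measure_sdiff_null (measure_singleton _)]
  rw [h1, Measure.prod_apply hTm, hk1, Nat.cast_add_one, ← lintegral_const_mul' _ _ (by finiteness)]
  refine lintegral_congr fun u => ?_
  rw [Nat.cast_add_one, ← volumeIoiPow_mul_lt_one]
  congr 2
  ext r
  simp [hT, hh r r.2]

/-- The integral of the power `-dim` of a positively homogeneous function over the sphere scales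
by the inverse determinant under a linear change of variables. -/
theorem lintegral_toSphere_comp_linearMap_rpow_neg_finrank {h : E → ℝ≥0∞} (hm : Measurable h)
    (hh : ∀ r : ℝ, 0 < r → ∀ x, h (r • x) = ENNReal.ofReal r * h x)
    {ψ : E →ₗ[ℝ] E} (hψ : LinearMap.det ψ ≠ 0) :
    ∫⁻ u : Metric.sphere (0 : E) 1, h (ψ u) ^ (-(Module.finrank ℝ E : ℝ)) ∂μ.toSphere =
      ENNReal.ofReal |(LinearMap.det ψ)⁻¹| *
        ∫⁻ u : Metric.sphere (0 : E) 1, h u ^ (-(Module.finrank ℝ E : ℝ)) ∂μ.toSphere := by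
  rw [lintegral_toSphere_rpow_neg_finrank μ hm hh,
    lintegral_toSphere_rpow_neg_finrank μ (h := fun x => h (ψ x))
      (hm.comp ψ.continuous_of_finiteDimensional.measurable) (fun r hr x => by
        rw [map_smul, hh r hr])]
  have := Measure.addHaar_preimage_linearMap μ hψ {x | h x < 1}
  rw [preimage_ofPred_eq] at this
  rw [this, mul_left_comm]

end SphereIntegral

/-! ### The reverse Minkowski inequality for negative exponents -/

/-- Convexity of `t ↦ t^{-r}`, from the weighted AM-GM inequality for `x, y` and again for `x^{-r},
y^{-r}`. -/
theorem ENNReal.rpow_neg_le_add_mul_rpow_neg {r : ℝ} (hr : 0 < r) {a b : NNReal} (ha : 0 < a)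
    (hb : 0 < b) (hab : a + b = 1) (x y : ℝ≥0∞) :
    (a * x + b * y) ^ (-r) ≤ a * x ^ (-r) + b * y ^ (-r) := by
  have hr' : -r < 0 := by linarith
  have ha' : (a : ℝ≥0∞) ≠ 0 := by simpa using ha.ne'
  have hb' : (b : ℝ≥0∞) ≠ 0 := by simpa using hb.ne'
  rcases eq_or_ne x 0 with rfl | hx
  · simp [ENNReal.zero_rpow_of_neg hr', ENNReal.mul_top ha']
  rcases eq_or_ne y 0 with rfl | hy
  · simp [ENNReal.zero_rpow_of_neg hr', ENNReal.mul_top hb']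
  rcases eq_or_ne x ⊤ with rfl | hxt
  · simp [ENNReal.mul_top ha', ENNReal.top_rpow_of_neg hr']
  rcases eq_or_ne y ⊤ with rfl | hyt
  · simp [ENNReal.mul_top hb', ENNReal.top_rpow_of_neg hr']
  lift x to NNReal using hxt
  lift y to NNReal using hyt
  have hx0 : 0 < x := pos_iff_ne_zero.2 (by simpa using hx)
  have hy0 : 0 < y := pos_iff_ne_zero.2 (by simpa using hy)
  rw [← ENNReal.coe_rpow_of_ne_zero hx0.ne', ← ENNReal.coe_rpow_of_ne_zero hy0.ne']
  norm_cast
  rw [← ENNReal.coe_rpow_of_ne_zero (by positivity)]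
  norm_cast
  have h1 := NNReal.geom_mean_le_arith_mean2_weighted a b x y hab
  have h2 := NNReal.geom_mean_le_arith_mean2_weighted a b (x ^ (-r)) (y ^ (-r)) hab
  calc (a * x + b * y) ^ (-r) ≤ (x ^ (a : ℝ) * y ^ (b : ℝ)) ^ (-r) :=
        NNReal.rpow_le_rpow_of_nonpos (by positivity) h1 hr'.le
    _ = (x ^ (-r)) ^ (a : ℝ) * (y ^ (-r)) ^ (b : ℝ) := by
        rw [NNReal.mul_rpow, ← NNReal.rpow_mul, ← NNReal.rpow_mul, ← NNReal.rpow_mul,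
          ← NNReal.rpow_mul, mul_comm (a : ℝ), mul_comm (b : ℝ)]
    _ ≤ _ := h2

theorem ENNReal.const_mul_rpow {c : ℝ≥0∞} (hc0 : c ≠ 0) (hct : c ≠ ⊤) (x : ℝ≥0∞) (z : ℝ) :
    (c * x) ^ z = c ^ z * x ^ z := by
  rw [ENNReal.mul_rpow_eq_ite]
  simp [hc0, hct]

theorem ENNReal.rpow_neg_anti {r : ℝ} (hr : 0 ≤ r) {x y : ℝ≥0∞} (h : x ≤ y) :
    y ^ (-r) ≤ x ^ (-r) := by
  rw [ENNReal.rpow_neg, ENNReal.rpow_neg]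
  exact ENNReal.inv_le_inv.2 (ENNReal.rpow_le_rpow h hr)

/-- With `A`, `B` the two means, `a = A/(A+B)` and `b = B/(A+B)`, convexity applied to `f + g = a
(f/a) + b (g/b)` bounds the integral by `a^{1+r} A^{-r} + b^{1+r} B^{-r} = (A+B)^{-r}`. If a mean is
`0` or `∞`, monotonicity suffices. -/
theorem ENNReal.add_lintegral_rpow_neg_le {α : Type*} [MeasurableSpace α] {μ : Measure α} {r : ℝ}
    (hr : 0 < r) {f g : α → ℝ≥0∞} (hf : Measurable f) :
    (∫⁻ x, f x ^ (-r) ∂μ) ^ (-(1 / r)) + (∫⁻ x, g x ^ (-r) ∂μ) ^ (-(1 / r)) ≤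
      (∫⁻ x, (f x + g x) ^ (-r) ∂μ) ^ (-(1 / r)) := by
  have hr1 : 0 ≤ 1 / r := by positivity
  have hA : (∫⁻ x, f x ^ (-r) ∂μ) ^ (-(1 / r)) ≤ (∫⁻ x, (f x + g x) ^ (-r) ∂μ) ^ (-(1 / r)) :=
    ENNReal.rpow_neg_anti hr1 (lintegral_mono fun x => ENNReal.rpow_neg_anti hr.le le_self_add)
  have hB : (∫⁻ x, g x ^ (-r) ∂μ) ^ (-(1 / r)) ≤ (∫⁻ x, (f x + g x) ^ (-r) ∂μ) ^ (-(1 / r)) :=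
    ENNReal.rpow_neg_anti hr1 (lintegral_mono fun x => ENNReal.rpow_neg_anti hr.le le_add_self)
  have hpow : ∀ I : ℝ≥0∞, (I ^ (-(1 / r))) ^ (-r) = I := fun I => by
    rw [← ENNReal.rpow_mul, neg_mul_neg, one_div_mul_cancel hr.ne', ENNReal.rpow_one]
  have hIf := hpow (∫⁻ x, f x ^ (-r) ∂μ)
  have hIg := hpow (∫⁻ x, g x ^ (-r) ∂μ)
  set A := (∫⁻ x, f x ^ (-r) ∂μ) ^ (-(1 / r))
  set B := (∫⁻ x, g x ^ (-r) ∂μ) ^ (-(1 / r))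
  rcases eq_or_ne A 0 with hA0 | hA0
  · rwa [hA0, zero_add]
  rcases eq_or_ne B 0 with hB0 | hB0
  · rwa [hB0, add_zero]
  rcases eq_or_ne A ⊤ with hAt | hAt
  · rw [hAt, top_le_iff] at hA
    rw [hA]; exact le_top
  rcases eq_or_ne B ⊤ with hBt | hBt
  · rw [hBt, top_le_iff] at hB
    rw [hB]; exact le_top
  clear_value A B
  lift A to NNReal using hAt
  lift B to NNReal using hBt
  have hA' : 0 < A := pos_iff_ne_zero.2 (by simpa using hA0)
  have hB' : 0 < B := pos_iff_ne_zero.2 (by simpa using hB0)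
  set S := A + B with hS
  have hS' : 0 < S := by positivity
  set a := A / S with ha
  set b := B / S with hb
  have ha' : 0 < a := by positivity
  have hb' : 0 < b := by positivity
  have hab : a + b = 1 := by rw [ha, hb, ← add_div, div_self hS'.ne']
  have hcancel : ∀ c : NNReal, 0 < c → ∀ t : ℝ≥0∞, (c : ℝ≥0∞) * ((c : ℝ≥0∞)⁻¹ * t) = t := by
    intro c hc t
    rw [← mul_assoc, ENNReal.mul_inv_cancel (by simpa using hc.ne') ENNReal.coe_ne_top, one_mul]
  have hscale : ∀ c : NNReal, 0 < c → ∀ t : ℝ≥0∞,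
      ((c : ℝ≥0∞)⁻¹ * t) ^ (-r) = ((c : ℝ≥0∞)) ^ r * t ^ (-r) := by
    intro c hc t
    rw [ENNReal.const_mul_rpow (by simp) (by simp [hc.ne']), ENNReal.inv_rpow,
      ENNReal.rpow_neg, inv_inv]
  have hint : ∫⁻ x, (f x + g x) ^ (-r) ∂μ ≤ (S : ℝ≥0∞) ^ (-r) := by
    calc ∫⁻ x, (f x + g x) ^ (-r) ∂μ
        ≤ ∫⁻ x, (a * (a : ℝ≥0∞) ^ r * f x ^ (-r) + b * (b : ℝ≥0∞) ^ r * g x ^ (-r)) ∂μ := by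
          refine lintegral_mono fun x => ?_
          have := ENNReal.rpow_neg_le_add_mul_rpow_neg hr ha' hb' hab
            ((a : ℝ≥0∞)⁻¹ * f x) ((b : ℝ≥0∞)⁻¹ * g x)
          rwa [hcancel a ha', hcancel b hb', hscale a ha', hscale b hb', ← mul_assoc,
            ← mul_assoc] at this
      _ = a * (a : ℝ≥0∞) ^ r * (A : ℝ≥0∞) ^ (-r) + b * (b : ℝ≥0∞) ^ r * (B : ℝ≥0∞) ^ (-r) := by
          rw [lintegral_add_left ((hf.pow_const _).const_mul _), lintegral_const_mul',
            lintegral_const_mul', hIf, hIg]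
          all_goals
            rw [← ENNReal.coe_rpow_of_nonneg _ hr.le]
            finiteness
      _ = (S : ℝ≥0∞) ^ (-r) := by
          rw [← ENNReal.coe_rpow_of_nonneg _ hr.le, ← ENNReal.coe_rpow_of_nonneg _ hr.le,
            ← ENNReal.coe_rpow_of_ne_zero hA'.ne', ← ENNReal.coe_rpow_of_ne_zero hB'.ne',
            ← ENNReal.coe_rpow_of_ne_zero hS'.ne']
          norm_cast
          have e : ∀ C : NNReal, 0 < C → C / S * (C / S) ^ r * C ^ (-r) = C / S * S ^ (-r) := by
            intro C hC
            have : C ^ r ≠ 0 := by positivity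
            rw [NNReal.div_rpow, NNReal.rpow_neg, NNReal.rpow_neg]
            field_simp
          rw [ha, hb, e A hA', e B hB', ← add_mul, ← add_div, div_self hS'.ne', one_mul]
  calc (A : ℝ≥0∞) + B = ((S : ℝ≥0∞) ^ (-r)) ^ (-(1 / r)) := by
        rw [← ENNReal.rpow_mul, neg_mul_neg, mul_one_div_cancel hr.ne', ENNReal.rpow_one, hS,
          ENNReal.coe_add]
    _ ≤ _ := ENNReal.rpow_neg_anti hr1 hint

/-! ### Radial functions -/

section RadialFun

variable {n : ℕ}

theorem radialFun_smul (K : Set (EuclideanSpace ℝ (Fin n))) {c : ℝ} (hc : 0 < c)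
    (x : EuclideanSpace ℝ (Fin n)) : radialFun K (c • x) = c⁻¹ * radialFun K x := by
  unfold radialFun
  rw [← smul_eq_mul, ← Real.sSup_smul_of_nonneg (inv_nonneg.2 hc.le)]
  congr 1
  ext r
  rw [mem_smul_set_iff_inv_smul_mem₀ (inv_ne_zero hc.ne')]
  simp only [mem_ofPred_eq, smul_smul, inv_inv, smul_eq_mul, mul_comm c r]
  exact and_congr_left fun _ => (mul_nonneg_iff_of_pos_right hc).symm

theorem radialFun_image (A : EuclideanSpace ℝ (Fin n) ≃L[ℝ] EuclideanSpace ℝ (Fin n))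
    (K : Set (EuclideanSpace ℝ (Fin n))) : radialFun (A '' K) = radialFun K ∘ A.symm := by
  ext x
  simp only [radialFun, Function.comp_apply]
  congr 1
  ext r
  simp only [mem_ofPred_eq, ← map_smul]
  rw [A.image_eq_preimage_symm, mem_preimage]

/-- The chain rule for an equivalence holds at every point: where differentiability fails, both
gradients are `0`. -/
theorem gradient_radialFun_image (A : EuclideanSpace ℝ (Fin n) ≃L[ℝ] EuclideanSpace ℝ (Fin n))
    (K : Set (EuclideanSpace ℝ (Fin n))) (z : EuclideanSpace ℝ (Fin n)) :
    gradient (radialFun (A '' K)) (A z) =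
      (A.symm : EuclideanSpace ℝ (Fin n) →L[ℝ] EuclideanSpace ℝ (Fin n)).adjoint
        (gradient (radialFun K) z) := by
  refine ext_inner_right ℝ fun y => ?_
  rw [ContinuousLinearMap.adjoint_inner_left, gradient, gradient,
    InnerProductSpace.toDual_symm_apply, InnerProductSpace.toDual_symm_apply, radialFun_image,
    A.symm.comp_right_fderiv]
  simp

theorem regularBoundary_image (A : EuclideanSpace ℝ (Fin n) ≃L[ℝ] EuclideanSpace ℝ (Fin n))
    (K : Set (EuclideanSpace ℝ (Fin n))) :
    regularBoundary (A '' K) = A '' regularBoundary K := by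
  ext w
  obtain ⟨z, rfl⟩ := A.surjective w
  have hf : frontier (A '' K) = A '' frontier K := (A.toHomeomorph.image_frontier K).symm
  rw [A.injective.mem_set_image]
  simp only [regularBoundary, mem_ofPred_eq, hf, A.injective.mem_set_image, radialFun_image]
  rw [A.symm.comp_right_differentiableAt_iff, A.symm_apply_apply]

theorem measurableSet_regularBoundary (K : Set (EuclideanSpace ℝ (Fin n))) :
    MeasurableSet (regularBoundary K) :=
  isClosed_frontier.measurableSet.inter (measurableSet_of_differentiableAt ℝ _)

theorem measurable_gradient (f : EuclideanSpace ℝ (Fin n) → ℝ) : Measurable (gradient f) :=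
  (InnerProductSpace.toDual ℝ (EuclideanSpace ℝ (Fin n))).symm.continuous.measurable.comp
    (measurable_fderiv ℝ f)

theorem measurable_outerNormal (K : Set (EuclideanSpace ℝ (Fin n))) :
    Measurable (outerNormal K) := by
  have := measurable_gradient (radialFun K)
  unfold outerNormal
  fun_prop

/-- Euler's identity in degree `-1`: differentiate `ρ_K(t z) = t⁻¹ ρ_K(z)` at `t = 1`. -/
theorem inner_gradient_radialFun_self {K : Set (EuclideanSpace ℝ (Fin n))}
    {z : EuclideanSpace ℝ (Fin n)} (hz : DifferentiableAt ℝ (radialFun K) z) :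
    inner ℝ (gradient (radialFun K) z) z = -radialFun K z := by
  have h1 : HasDerivAt (fun t : ℝ => radialFun K (t • z)) (fderiv ℝ (radialFun K) z z) 1 := by
    have hl : HasDerivAt (fun t : ℝ => t • z) z 1 := by
      simpa using (hasDerivAt_id (1 : ℝ)).smul_const z
    have hf : HasFDerivAt (radialFun K) (fderiv ℝ (radialFun K) z) ((1 : ℝ) • z) := by
      simpa using hz.hasFDerivAt
    exact hf.comp_hasDerivAt 1 hl
  have h2 : HasDerivAt (fun t : ℝ => radialFun K (t • z)) (-radialFun K z) 1 := by
    have h3 : HasDerivAt (fun t : ℝ => t⁻¹ * radialFun K z) (-radialFun K z) 1 := by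
      simpa using (hasDerivAt_inv (one_ne_zero (α := ℝ))).mul_const (radialFun K z)
    refine h3.congr_of_eventuallyEq ?_
    filter_upwards [lt_mem_nhds (zero_lt_one (α := ℝ))] with t ht using radialFun_smul K ht z
  rw [gradient, InnerProductSpace.toDual_symm_apply]
  exact h1.unique h2

theorem IsLipschitzStarBody.radialFun_pos_of_ne_zero {K : Set (EuclideanSpace ℝ (Fin n))}
    (hK : IsLipschitzStarBody K) {x : EuclideanSpace ℝ (Fin n)} (hx : x ≠ 0) :
    0 < radialFun K x := by
  have hx' : 0 < ‖x‖ := norm_pos_iff.2 hx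
  have h := hK.radialFun_pos (‖x‖⁻¹ • x) (by simp [norm_smul, hx'.ne'])
  rw [radialFun_smul K (inv_pos.2 hx')] at h
  simpa [hx'] using h

theorem IsLipschitzStarBody.mem_of_one_lt_radialFun {K : Set (EuclideanSpace ℝ (Fin n))}
    (hK : IsLipschitzStarBody K) {x : EuclideanSpace ℝ (Fin n)} (hx : 1 < radialFun K x) :
    x ∈ K := by
  have hne : {r : ℝ | 0 ≤ r ∧ r • x ∈ K}.Nonempty := by
    by_contra h
    rw [not_nonempty_iff_eq_empty] at h
    rw [radialFun, h, Real.sSup_empty] at hx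
    linarith
  obtain ⟨r, ⟨-, hrK⟩, hr1⟩ := exists_lt_of_lt_csSup hne hx
  have := hK.starShaped _ hrK r⁻¹ ⟨by positivity, inv_le_one_of_one_le₀ hr1.le⟩
  rwa [smul_smul, inv_mul_cancel₀ (by positivity), one_smul] at this

theorem IsLipschitzStarBody.one_le_radialFun_of_mem {K : Set (EuclideanSpace ℝ (Fin n))}
    (hK : IsLipschitzStarBody K) {x : EuclideanSpace ℝ (Fin n)} (hx : x ≠ 0) (hxK : x ∈ K) :
    1 ≤ radialFun K x := by
  -- An unbounded set has real supremum `0`, which positivity of the radial function excludes.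
  have hbdd : BddAbove {r : ℝ | 0 ≤ r ∧ r • x ∈ K} := by
    by_contra h
    have := hK.radialFun_pos_of_ne_zero hx
    rw [radialFun, Real.sSup_of_not_bddAbove h] at this
    exact lt_irrefl _ this
  exact le_csSup hbdd ⟨zero_le_one, by simpa using hxK⟩

theorem IsLipschitzStarBody.continuousAt_radialFun {K : Set (EuclideanSpace ℝ (Fin n))}
    (hK : IsLipschitzStarBody K) {z : EuclideanSpace ℝ (Fin n)} (hz : z ≠ 0) :
    ContinuousAt (radialFun K) z := by
  have hcont : ContinuousOn (fun x : EuclideanSpace ℝ (Fin n) =>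
      ‖x‖⁻¹ * radialFun K (‖x‖⁻¹ • x)) {0}ᶜ := by
    have h1 : ContinuousOn (fun x : EuclideanSpace ℝ (Fin n) => ‖x‖⁻¹) {0}ᶜ :=
      continuous_norm.continuousOn.inv₀ fun x hx => norm_ne_zero_iff.2 hx
    refine h1.mul (hK.continuousOn_radialFun.comp (h1.smul continuousOn_id) fun x hx => ?_)
    have : ‖x‖ ≠ 0 := norm_ne_zero_iff.2 hx
    simp [norm_smul, this]
  have hat := hcont.continuousAt (isOpen_compl_singleton.mem_nhds hz)
  refine hat.congr ?_
  filter_upwards [isOpen_compl_singleton.mem_nhds hz] with x hx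
  have hx' : 0 < ‖x‖ := norm_pos_iff.2 hx
  rw [radialFun_smul K (inv_pos.2 hx'), inv_inv, inv_mul_cancel_left₀ hx'.ne']

theorem IsLipschitzStarBody.zero_mem_interior (hn : 0 < n) {K : Set (EuclideanSpace ℝ (Fin n))}
    (hK : IsLipschitzStarBody K) : (0 : EuclideanSpace ℝ (Fin n)) ∈ interior K := by
  have : Nonempty (Fin n) := ⟨⟨0, hn⟩⟩
  obtain ⟨u, hu, hmin⟩ := (isCompact_sphere (0 : EuclideanSpace ℝ (Fin n)) 1).exists_isMinOn
    (NormedSpace.sphere_nonempty.2 zero_le_one) hK.continuousOn_radialFun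
  have hδ := hK.radialFun_pos u hu
  have hmem : ∀ x : EuclideanSpace ℝ (Fin n), x ≠ 0 → ‖x‖ < radialFun K u → x ∈ K := by
    intro x hx hxδ
    have hx' : 0 < ‖x‖ := norm_pos_iff.2 hx
    have h1 : radialFun K u ≤ radialFun K (‖x‖⁻¹ • x) :=
      hmin (by simp [norm_smul, hx'.ne'] : ‖x‖⁻¹ • x ∈ Metric.sphere (0 : EuclideanSpace ℝ (Fin n)) 1)
    rw [radialFun_smul K (inv_pos.2 hx'), inv_inv] at h1
    refine hK.mem_of_one_lt_radialFun ?_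
    by_contra! h2
    have := mul_le_mul_of_nonneg_left h2 hx'.le
    linarith
  -- The origin is reached by shrinking a nonzero point of `K` with factor `0`.
  have h0 : (0 : EuclideanSpace ℝ (Fin n)) ∈ K := by
    have hu1 : ‖u‖ = 1 := by simpa using hu
    have hu0 : u ≠ 0 := by
      rintro rfl
      simp at hu1
    have hy : (radialFun K u / 2) • u ∈ K := by
      refine hmem _ (smul_ne_zero (by positivity) hu0) ?_
      rw [norm_smul, hu1, Real.norm_of_nonneg (by positivity)]
      linarith
    simpa using hK.starShaped _ hy 0 ⟨le_rfl, zero_le_one⟩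
  refine mem_interior.2 ⟨Metric.ball 0 (radialFun K u), fun x hx => ?_, Metric.isOpen_ball,
    Metric.mem_ball_self hδ⟩
  by_cases hx0 : x = 0
  · rwa [hx0]
  · exact hmem x hx0 (by simpa using hx)

/-- Away from the origin, which is interior, `{ρ_K > 1}` is open and inside `K`, and `{ρ_K < 1}` is
open and misses `K`. Later arguments use the star body only through this identity. -/
theorem IsLipschitzStarBody.radialFun_eq_one (hn : 0 < n) {K : Set (EuclideanSpace ℝ (Fin n))}
    (hK : IsLipschitzStarBody K) {z : EuclideanSpace ℝ (Fin n)} (hz : z ∈ frontier K) :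
    radialFun K z = 1 := by
  have hz0 : z ≠ 0 := by
    rintro rfl
    exact hz.2 (hK.zero_mem_interior hn)
  have hc := hK.continuousAt_radialFun hz0
  refine le_antisymm (not_lt.1 fun h => hz.2 ?_) (not_lt.1 fun h => ?_)
  · refine mem_interior_iff_mem_nhds.2 ?_
    filter_upwards [hc.eventually (lt_mem_nhds h)] with x hx using hK.mem_of_one_lt_radialFun hx
  · obtain ⟨x, hx, hxK⟩ := mem_closure_iff_nhds.1 hz.1 _ (Filter.inter_mem
      (hc.eventually (gt_mem_nhds h)) (isOpen_compl_singleton.mem_nhds hz0))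
    exact absurd hx.1 (not_lt.2 (hK.one_le_radialFun_of_mem hx.2 hxK))

end RadialFun

/-! ### The `p`-th power of the support function of the projection body -/

section ProjBody

variable {n m : ℕ}

/-- The `p`-th power of the support function of the projection body, expressed through the
gradient of the radial function instead of the normal. -/
noncomputable def projBodyIntegral (p : ℝ) (Q : Set (EuclideanSpace ℝ (Fin m)))
    (K : Set (EuclideanSpace ℝ (Fin n))) (x : EuclideanSpace ℝ (Fin n × Fin m)) : ℝ≥0∞ :=
  ∫⁻ z in regularBoundary K,
    ENNReal.ofReal (supportFun Q (rowMul (-gradient (radialFun K) z) x) ^ p *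
      ‖gradient (radialFun K) z‖⁻¹) ∂μHE[n - 1]

theorem rowMul_smul_left (c : ℝ) (v : EuclideanSpace ℝ (Fin n))
    (x : EuclideanSpace ℝ (Fin n × Fin m)) : rowMul (c • v) x = c • rowMul v x := by
  ext j
  simp [rowMul, Finset.mul_sum, mul_assoc]

theorem rowMul_smul_right (c : ℝ) (v : EuclideanSpace ℝ (Fin n))
    (x : EuclideanSpace ℝ (Fin n × Fin m)) : rowMul v (c • x) = c • rowMul v x := by
  ext j
  simp [rowMul, Finset.mul_sum, mul_left_comm]

theorem gradient_radialFun_ne_zero {K : Set (EuclideanSpace ℝ (Fin n))}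
    (hK : ∀ z ∈ frontier K, radialFun K z = 1) {z : EuclideanSpace ℝ (Fin n)}
    (hz : z ∈ regularBoundary K) : gradient (radialFun K) z ≠ 0 := by
  intro h
  have := inner_gradient_radialFun_self hz.2
  rw [h, hK z hz.1, inner_zero_left] at this
  linarith

theorem norm_outerNormal {K : Set (EuclideanSpace ℝ (Fin n))} {z : EuclideanSpace ℝ (Fin n)}
    (hz : gradient (radialFun K) z ≠ 0) : ‖outerNormal K z‖ = 1 := by
  have : ‖gradient (radialFun K) z‖ ≠ 0 := norm_ne_zero_iff.2 hz
  simp [outerNormal, norm_smul, this]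

/-- Homogeneity of `h_Q` contributes `|g|^{-p}` and `(z ⬝ ν)^{1-p}` contributes `|g|^{p-1}`;
together they give `|g|⁻¹`. -/
theorem projBodySupport_eq {p : ℝ} {Q : Set (EuclideanSpace ℝ (Fin m))} (hQ : IsConvexBodyO Q)
    {K : Set (EuclideanSpace ℝ (Fin n))} (hK : ∀ z ∈ frontier K, radialFun K z = 1)
    (x : EuclideanSpace ℝ (Fin n × Fin m)) :
    projBodySupport p Q K x = projBodyIntegral p Q K x ^ (1 / p) := by
  unfold projBodySupport projBodyIntegral
  congr 1
  refine setLIntegral_congr_fun (measurableSet_regularBoundary K) fun z hz => ?_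
  set g := gradient (radialFun K) z with hg
  have hgn : 0 < ‖g‖ := norm_pos_iff.2 (gradient_radialFun_ne_zero hK hz)
  have hν : outerNormal K z = ‖g‖⁻¹ • -g := by rw [outerNormal, smul_neg]
  have hi : inner ℝ z (outerNormal K z) = ‖g‖⁻¹ := by
    rw [hν, real_inner_smul_right, inner_neg_right, real_inner_comm,
      inner_gradient_radialFun_self hz.2, hK z hz.1]
    ring
  rw [hi, hν, rowMul_smul_left, supportFun_smul_arg _ (inv_nonneg.2 hgn.le),
    Real.mul_rpow (inv_nonneg.2 hgn.le) (hQ.supportFun_nonneg _),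
    Real.rpow_sub (inv_pos.2 hgn), Real.rpow_one]
  have : ‖g‖⁻¹ ^ p ≠ 0 := by positivity
  congr 1
  field_simp

theorem supportFun_continuous {Q : Set (EuclideanSpace ℝ (Fin m))} (hQ : IsConvexBodyO Q) :
    Continuous (supportFun Q) := by
  obtain ⟨R, hR⟩ := hQ.isCompact.isBounded.exists_norm_le
  have hR0 : 0 ≤ R := (norm_nonneg _).trans (hR 0 hQ.zero_mem)
  have hle : ∀ x, supportFun Q x ≤ R * ‖x‖ := fun x => by
    refine csSup_le (Set.Nonempty.image _ ⟨0, hQ.zero_mem⟩) ?_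
    rintro _ ⟨y, hy, rfl⟩
    calc inner ℝ x y ≤ ‖x‖ * ‖y‖ := real_inner_le_norm _ _
      _ ≤ R * ‖x‖ := by rw [mul_comm]; gcongr; exact hR y hy
  refine (LipschitzWith.of_le_add_mul ⟨R, hR0⟩ fun x y => ?_).continuous
  have h1 := hQ.supportFun_add_le y (x - y)
  rw [add_sub_cancel] at h1
  rw [dist_eq_norm]
  exact h1.trans (by gcongr; exact hle _)

theorem measurable_projBody_integrand {p : ℝ} (hp : 0 ≤ p) {Q : Set (EuclideanSpace ℝ (Fin m))}
    (hQ : IsConvexBodyO Q) {G : EuclideanSpace ℝ (Fin n) → EuclideanSpace ℝ (Fin n)}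
    (hG : Measurable G) (x : EuclideanSpace ℝ (Fin n × Fin m)) :
    Measurable fun z => ENNReal.ofReal (supportFun Q (rowMul (-G z) x) ^ p * ‖G z‖⁻¹) := by
  have hrow : Continuous fun v : EuclideanSpace ℝ (Fin n) => rowMul v x := by
    unfold rowMul
    fun_prop
  have hc : Continuous fun v : EuclideanSpace ℝ (Fin n) => supportFun Q (rowMul v x) ^ p :=
    ((supportFun_continuous hQ).comp hrow).rpow_const fun _ => Or.inr hp
  have h1 : Measurable fun z => supportFun Q (rowMul (-G z) x) ^ p :=
    hc.measurable.comp hG.neg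
  have h2 : Measurable fun z => ‖G z‖⁻¹ := hG.norm.inv
  exact ENNReal.measurable_ofReal.comp (h1.mul h2)

/-- Fatou's lemma makes the integral lower semicontinuous in `x`; this asks for no σ-finiteness of
the measure. -/
theorem measurable_projBodyIntegral {p : ℝ} (hp : 0 ≤ p) {Q : Set (EuclideanSpace ℝ (Fin m))}
    (hQ : IsConvexBodyO Q) (K : Set (EuclideanSpace ℝ (Fin n))) :
    Measurable (projBodyIntegral p Q K) := by
  refine LowerSemicontinuous.measurable fun x => ?_
  refine lowerSemicontinuousAt_iff_le_liminf.2 ?_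
  refine le_trans (lintegral_mono fun z => ?_)
    (lintegral_liminf_le fun y => measurable_projBody_integrand hp hQ (measurable_gradient (radialFun K)) y)
  have hrow : Continuous fun y : EuclideanSpace ℝ (Fin n × Fin m) =>
      rowMul (-gradient (radialFun K) z) y := by
    unfold rowMul
    fun_prop
  have hc : Continuous fun y => ENNReal.ofReal
      (supportFun Q (rowMul (-gradient (radialFun K) z) y) ^ p *
        ‖gradient (radialFun K) z‖⁻¹) :=
    ENNReal.continuous_ofReal.comp ((((supportFun_continuous hQ).comp hrow).rpow_const
      fun _ => Or.inr hp).mul continuous_const)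
  exact ((hc.tendsto x).liminf_eq).ge

theorem projBodyIntegral_smul {p : ℝ} {Q : Set (EuclideanSpace ℝ (Fin m))}
    (hQ : IsConvexBodyO Q) (K : Set (EuclideanSpace ℝ (Fin n))) {r : ℝ} (hr : 0 < r)
    (x : EuclideanSpace ℝ (Fin n × Fin m)) :
    projBodyIntegral p Q K (r • x) = ENNReal.ofReal (r ^ p) * projBodyIntegral p Q K x := by
  unfold projBodyIntegral
  rw [← lintegral_const_mul' _ _ ENNReal.ofReal_ne_top]
  refine lintegral_congr fun z => ?_
  rw [rowMul_smul_right, supportFun_smul_arg _ hr.le,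
    Real.mul_rpow hr.le (hQ.supportFun_nonneg _), ← ENNReal.ofReal_mul (by positivity), mul_assoc]

theorem projBodyIntegral_image_le (hn : 0 < n) {p : ℝ} {Q : Set (EuclideanSpace ℝ (Fin m))}
    (hQ : IsConvexBodyO Q) {K : Set (EuclideanSpace ℝ (Fin n))}
    (hK : ∀ z ∈ frontier K, radialFun K z = 1)
    (A : EuclideanSpace ℝ (Fin n) ≃L[ℝ] EuclideanSpace ℝ (Fin n))
    {x y : EuclideanSpace ℝ (Fin n × Fin m)}
    (hxy : ∀ v, rowMul ((A.symm : EuclideanSpace ℝ (Fin n) →L[ℝ]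
      EuclideanSpace ℝ (Fin n)).adjoint v) y = rowMul v x) :
    projBodyIntegral p Q (A '' K) y ≤
      ENNReal.ofReal |LinearMap.det (A : EuclideanSpace ℝ (Fin n) →ₗ[ℝ] EuclideanSpace ℝ (Fin n))| *
        projBodyIntegral p Q K x := by
  unfold projBodyIntegral
  rw [regularBoundary_image, ← lintegral_const_mul' _ _ ENNReal.ofReal_ne_top]
  refine (lintegral_image_le_lintegral_hyperplaneJacobian (by simp; omega) A
    (measurableSet_regularBoundary K) (measurable_outerNormal K)
    (fun z hz => norm_outerNormal (gradient_radialFun_ne_zero hK hz)) ?_ _).trans_eq ?_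
  · intro z hz
    -- Derivatives within a thin set are not unique: `ρ_K` equals `1` on the boundary, so there the
    -- constant `1` inherits the derivative of `ρ_K`. Subtracting `1` and rescaling gives the
    -- normality condition for `ν`.
    have h1 : HasFDerivWithinAt (fun _ => (1 : ℝ)) (fderiv ℝ (radialFun K) z)
        (regularBoundary K) z :=
      hz.2.hasFDerivAt.hasFDerivWithinAt.congr (fun w hw => (hK w hw.1).symm) (hK z hz.1).symm
    have h2 := (h1.sub_const 1).const_smul (-‖gradient (radialFun K) z‖⁻¹)
    refine (h2.congr_fderiv ?_).congr (fun _ _ => by simp) (by simp)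
    ext u
    have : inner ℝ (gradient (radialFun K) z) u = fderiv ℝ (radialFun K) z u := by
      rw [gradient, InnerProductSpace.toDual_symm_apply]
    simp [outerNormal, this]
  · refine setLIntegral_congr_fun (measurableSet_regularBoundary K) fun z hz => ?_
    have hg0 := gradient_radialFun_ne_zero hK hz
    set g := gradient (radialFun K) z with hg
    set B := (A.symm : EuclideanSpace ℝ (Fin n) →L[ℝ] EuclideanSpace ℝ (Fin n)).adjoint with hB
    have hBg : 0 < ‖B g‖ := by
      refine norm_pos_iff.2 fun h => hg0 ?_
      have := inner_adjoint_symm_apply A g g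
      rw [← hB, h, inner_zero_left] at this
      exact inner_self_eq_zero.1 this.symm
    have hgn : 0 < ‖g‖ := norm_pos_iff.2 hg0
    have hsupp := Real.rpow_nonneg (hQ.supportFun_nonneg (rowMul (-g) x)) p
    have hJ : hyperplaneJacobian A (outerNormal K z) =
        |LinearMap.det (A : EuclideanSpace ℝ (Fin n) →ₗ[ℝ] EuclideanSpace ℝ (Fin n))| *
          (‖g‖⁻¹ * ‖B g‖) := by
      rw [hyperplaneJacobian, outerNormal, ← hg, ← hB, map_neg, map_smul, norm_neg, norm_smul,
        norm_inv, norm_norm]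
    rw [gradient_radialFun_image, ← hg, ← hB, ← map_neg, hxy, hJ,
      ← ENNReal.ofReal_mul (by positivity), ← ENNReal.ofReal_mul (by positivity)]
    congr 1
    field_simp

theorem radialFun_eq_one_of_mem_frontier_image {K : Set (EuclideanSpace ℝ (Fin n))}
    (hK : ∀ z ∈ frontier K, radialFun K z = 1)
    (A : EuclideanSpace ℝ (Fin n) ≃L[ℝ] EuclideanSpace ℝ (Fin n)) :
    ∀ w ∈ frontier (A '' K), radialFun (A '' K) w = 1 := by
  intro w hw
  have hf : frontier (A '' K) = A '' frontier K := (A.toHomeomorph.image_frontier K).symm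
  obtain ⟨z, hz, rfl⟩ := hf ▸ hw
  simpa [radialFun_image] using hK z hz

/-- The reverse inequality is the same bound for `A⁻¹` acting on `A '' K`, the two determinants
being inverse. -/
theorem projBodyIntegral_image (hn : 0 < n) {p : ℝ} {Q : Set (EuclideanSpace ℝ (Fin m))}
    (hQ : IsConvexBodyO Q) {K : Set (EuclideanSpace ℝ (Fin n))}
    (hK : ∀ z ∈ frontier K, radialFun K z = 1)
    (A : EuclideanSpace ℝ (Fin n) ≃L[ℝ] EuclideanSpace ℝ (Fin n))
    {x y : EuclideanSpace ℝ (Fin n × Fin m)}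
    (hxy : ∀ v, rowMul ((A.symm : EuclideanSpace ℝ (Fin n) →L[ℝ]
      EuclideanSpace ℝ (Fin n)).adjoint v) y = rowMul v x) :
    projBodyIntegral p Q (A '' K) y =
      ENNReal.ofReal |LinearMap.det (A : EuclideanSpace ℝ (Fin n) →ₗ[ℝ] EuclideanSpace ℝ (Fin n))| *
        projBodyIntegral p Q K x := by
  refine le_antisymm (projBodyIntegral_image_le hn hQ hK A hxy) ?_
  have hyx : ∀ v, rowMul ((A.symm.symm : EuclideanSpace ℝ (Fin n) →L[ℝ]
      EuclideanSpace ℝ (Fin n)).adjoint v) x = rowMul v y := by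
    intro v
    rw [← hxy]
    congr 1
    refine ext_inner_right ℝ fun u => ?_
    simp [ContinuousLinearMap.adjoint_inner_left]
  have h := projBodyIntegral_image_le hn (p := p) hQ
    (radialFun_eq_one_of_mem_frontier_image hK A) A.symm hyx
  have hAA : A.symm '' (A '' K) = K := by simp [image_image]
  have hdet : LinearMap.det (A : EuclideanSpace ℝ (Fin n) →ₗ[ℝ] EuclideanSpace ℝ (Fin n)) *
      LinearMap.det (A.symm : EuclideanSpace ℝ (Fin n) →ₗ[ℝ] EuclideanSpace ℝ (Fin n)) = 1 := by
    rw [← LinearMap.det_comp]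
    convert LinearMap.det_id (A := ℝ) (M := EuclideanSpace ℝ (Fin n))
    ext u
    simp
  rw [hAA] at h
  refine (mul_le_mul_right h _).trans_eq ?_
  rw [← mul_assoc, ← ENNReal.ofReal_mul (abs_nonneg _), ← abs_mul, hdet]
  simp

end ProjBody

/-! ### Operations on convex bodies -/

section ConvexBody

variable {m : ℕ}

theorem IsConvexBodyO.smul {Q : Set (EuclideanSpace ℝ (Fin m))} (hQ : IsConvexBodyO Q) {b : ℝ}
    (hb : b ≠ 0) : IsConvexBodyO (b • Q) where
  convex := hQ.convex.smul b
  isCompact := hQ.isCompact.smul b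
  interior_nonempty := by
    rw [interior_smul₀ hb]
    exact hQ.interior_nonempty.smul_set
  zero_mem := ⟨0, hQ.zero_mem, smul_zero b⟩

theorem IsConvexBodyO.neg {Q : Set (EuclideanSpace ℝ (Fin m))} (hQ : IsConvexBodyO Q) :
    IsConvexBodyO (-Q) := by
  simpa using hQ.smul (b := -1) (by norm_num)

theorem supportFun_smul_set (Q : Set (EuclideanSpace ℝ (Fin m))) {b : ℝ} (hb : 0 ≤ b)
    (x : EuclideanSpace ℝ (Fin m)) : supportFun (b • Q) x = b * supportFun Q x := by
  rw [← supportFun_smul_arg Q hb]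
  unfold supportFun
  rw [← image_smul, image_image]
  simp [real_inner_smul_left, real_inner_smul_right]

theorem supportFun_neg_set (Q : Set (EuclideanSpace ℝ (Fin m))) (x : EuclideanSpace ℝ (Fin m)) :
    supportFun (-Q) x = supportFun Q (-x) := by
  unfold supportFun
  rw [← image_neg_eq_neg, image_image]
  simp

end ConvexBody

/-! ### Means of negative exponent over the sphere -/

section SphereMean

/-- The mean of exponent `-r` of a function over the unit sphere, with respect to the
(unnormalized) surface measure. -/
noncomputable def sphereNegMean {ι : Type*} [Fintype ι] (r : ℝ)
    (f : EuclideanSpace ℝ ι → ℝ≥0∞) : ℝ≥0∞ :=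
  (∫⁻ u : Metric.sphere (0 : EuclideanSpace ℝ ι) 1, f u ^ (-r)
    ∂(volume : Measure (EuclideanSpace ℝ ι)).toSphere) ^ (-(1 / r))

variable {ι : Type*} [Fintype ι] {r : ℝ}

theorem sphereNegMean_mono (hr : 0 < r) {f g : EuclideanSpace ℝ ι → ℝ≥0∞} (h : ∀ x, f x ≤ g x) :
    sphereNegMean r f ≤ sphereNegMean r g :=
  ENNReal.rpow_neg_anti (by positivity)
    (lintegral_mono fun u => ENNReal.rpow_neg_anti hr.le (h u))

theorem sphereNegMean_const_mul (hr : 0 < r) {c : ℝ≥0∞} (hc0 : c ≠ 0) (hct : c ≠ ⊤)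
    (f : EuclideanSpace ℝ ι → ℝ≥0∞) :
    sphereNegMean r (fun x => c * f x) = c * sphereNegMean r f := by
  have hc0' : c ^ (-r) ≠ 0 := by simp [ENNReal.rpow_eq_zero_iff, hc0, hct]
  have hct' : c ^ (-r) ≠ ⊤ := by simp [ENNReal.rpow_eq_top_iff, hc0, hct]
  unfold sphereNegMean
  simp_rw [ENNReal.const_mul_rpow hc0 hct]
  rw [lintegral_const_mul' _ _ hct', ENNReal.const_mul_rpow hc0' hct', ← ENNReal.rpow_mul,
    neg_mul_neg, mul_one_div_cancel hr.ne', ENNReal.rpow_one]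

theorem sphereNegMean_add_le (hr : 0 < r) {f g : EuclideanSpace ℝ ι → ℝ≥0∞} (hf : Measurable f) :
    sphereNegMean r f + sphereNegMean r g ≤ sphereNegMean r fun x => f x + g x :=
  ENNReal.add_lintegral_rpow_neg_le (f := fun u : Metric.sphere (0 : EuclideanSpace ℝ ι) 1 => f u)
    hr (hf.comp measurable_subtype_coe)

/-- `f ^ (1 / p)` has degree one, so the integral scales by `|det ψ|⁻¹`; the outer exponent `-p/N`,
with `N` the dimension, turns this into `|det ψ|^{p/N}`. -/
theorem sphereNegMean_comp_linearMap [Nonempty ι] {p : ℝ} (hp : 0 < p)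
    {f : EuclideanSpace ℝ ι → ℝ≥0∞} (hf : Measurable f)
    (hh : ∀ c : ℝ, 0 < c → ∀ x, f (c • x) = ENNReal.ofReal (c ^ p) * f x)
    {ψ : EuclideanSpace ℝ ι →ₗ[ℝ] EuclideanSpace ℝ ι} (hψ : LinearMap.det ψ ≠ 0) :
    sphereNegMean (Fintype.card ι / p) (fun x => f (ψ x)) =
      ENNReal.ofReal (|LinearMap.det ψ| ^ (p / Fintype.card ι)) *
        sphereNegMean (Fintype.card ι / p) f := by
  have hN : (0 : ℝ) < Fintype.card ι := by exact_mod_cast Fintype.card_pos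
  have key := lintegral_toSphere_comp_linearMap_rpow_neg_finrank
    (volume : Measure (EuclideanSpace ℝ ι)) (h := fun x => f x ^ (1 / p)) (hf.pow_const _)
    (fun c hc x => by
      rw [hh c hc, ENNReal.mul_rpow_of_nonneg _ _ (by positivity),
        ENNReal.ofReal_rpow_of_pos (by positivity), ← Real.rpow_mul hc.le,
        mul_one_div_cancel hp.ne', Real.rpow_one]) hψ
  have he : ∀ y : ℝ≥0∞, (y ^ (1 / p)) ^ (-(Module.finrank ℝ (EuclideanSpace ℝ ι) : ℝ)) =
      y ^ (-((Fintype.card ι : ℝ) / p)) := fun y => by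
    rw [← ENNReal.rpow_mul, finrank_euclideanSpace]
    congr 1
    ring
  simp_rw [he] at key
  have hd : 0 < |LinearMap.det ψ| := abs_pos.2 hψ
  unfold sphereNegMean
  rw [key, ENNReal.const_mul_rpow (by simpa using hψ) ENNReal.ofReal_ne_top,
    ENNReal.ofReal_rpow_of_pos (by positivity), abs_inv, Real.inv_rpow hd.le,
    ← Real.rpow_neg hd.le, neg_neg, one_div_div]

end SphereMean

/-! ### Homogeneity, symmetry, concavity and affine invariance -/

section IntAffineSurfaceArea

variable {n m : ℕ} {p : ℝ}

theorem intAffineSurfaceArea_eq {Q : Set (EuclideanSpace ℝ (Fin m))}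
    (hQ : IsConvexBodyO Q) {K : Set (EuclideanSpace ℝ (Fin n))}
    (hK : ∀ z ∈ frontier K, radialFun K z = 1) :
    intAffineSurfaceArea p Q K =
      sphereNegMean (Fintype.card (Fin n × Fin m) / p) (projBodyIntegral p Q K) := by
  unfold intAffineSurfaceArea sphereNegMean
  simp_rw [projBodySupport_eq hQ hK, ← ENNReal.rpow_mul]
  rw [one_div_div]
  simp only [Fintype.card_prod, Fintype.card_fin, Nat.cast_mul]
  congr 2
  ext u
  congr 1
  ring

/-- Left multiplication of an `n × m` matrix by an `n × n` matrix. -/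
noncomputable def leftMulMatrix (M : Matrix (Fin n) (Fin n) ℝ) :
    EuclideanSpace ℝ (Fin n × Fin m) →ₗ[ℝ] EuclideanSpace ℝ (Fin n × Fin m) :=
  Matrix.toEuclideanLin (Matrix.kroneckerMap (· * ·) M (1 : Matrix (Fin m) (Fin m) ℝ))

theorem det_leftMulMatrix (M : Matrix (Fin n) (Fin n) ℝ) :
    LinearMap.det (leftMulMatrix (m := m) M) = M.det ^ m := by
  rw [leftMulMatrix, LinearMap.det_toLpLin, Matrix.det_kronecker]
  simp

theorem rowMul_apply_eq_inner (v : EuclideanSpace ℝ (Fin n))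
    (x : EuclideanSpace ℝ (Fin n × Fin m)) (j : Fin m) :
    rowMul v x j = inner ℝ v (WithLp.toLp 2 fun i => x (i, j)) := by
  simp [rowMul, PiLp.inner_apply, mul_comm]

theorem rowMul_adjoint_leftMulMatrix {M : Matrix (Fin n) (Fin n) ℝ}
    {A : EuclideanSpace ℝ (Fin n) ≃L[ℝ] EuclideanSpace ℝ (Fin n)}
    (hA : ∀ x, A x = Matrix.toEuclideanLin M x) (v : EuclideanSpace ℝ (Fin n))
    (x : EuclideanSpace ℝ (Fin n × Fin m)) :
    rowMul ((A.symm : EuclideanSpace ℝ (Fin n) →L[ℝ] EuclideanSpace ℝ (Fin n)).adjoint v)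
      (leftMulMatrix M x) = rowMul v x := by
  ext j
  rw [rowMul_apply_eq_inner, rowMul_apply_eq_inner,
    ← inner_adjoint_symm_apply A v (WithLp.toLp 2 fun i => x (i, j)), hA]
  congr 1
  ext i
  simp [leftMulMatrix, Matrix.toLpLin_apply, Matrix.mulVec, dotProduct, Fintype.sum_prod_type,
    Matrix.one_apply]

/-- Two evaluations of the mean of `x ↦ P_{Q,AK}(Mx)` give `|det M|^{p/n} Φ(AK) = |det M| Φ(K)`. The
first conjunct lets further results be applied to the image. -/
theorem intAffineSurfaceArea_image (hn : 0 < n) (hm : 0 < m) (hp : 1 ≤ p)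
    {Q : Set (EuclideanSpace ℝ (Fin m))} (hQ : IsConvexBodyO Q)
    {K : Set (EuclideanSpace ℝ (Fin n))} (hK : ∀ z ∈ frontier K, radialFun K z = 1)
    {M : Matrix (Fin n) (Fin n) ℝ} (hM : M.det ≠ 0) :
    (∀ w ∈ frontier (Matrix.toEuclideanLin M '' K),
      radialFun (Matrix.toEuclideanLin M '' K) w = 1) ∧
    intAffineSurfaceArea p Q (Matrix.toEuclideanLin M '' K) =
      ENNReal.ofReal (|M.det| ^ (((n : ℝ) - p) / n)) * intAffineSurfaceArea p Q K := by
  have hp0 : 0 < p := by positivity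
  have hdet : LinearMap.det (Matrix.toEuclideanLin M) ≠ 0 := by
    rwa [LinearMap.det_toLpLin]
  set A := ((Matrix.toEuclideanLin M).equivOfDetNeZero hdet).toContinuousLinearEquiv with hA
  have hAM : ∀ x, A x = Matrix.toEuclideanLin M x := fun _ => rfl
  have himg : Matrix.toEuclideanLin M '' K = A '' K := rfl
  have hAdet : LinearMap.det (A : EuclideanSpace ℝ (Fin n) →ₗ[ℝ] EuclideanSpace ℝ (Fin n)) =
      M.det := by
    rw [← LinearMap.det_toLpLin 2 M]
    rfl
  have hK' := radialFun_eq_one_of_mem_frontier_image hK A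
  rw [himg]
  refine ⟨hK', ?_⟩
  have hD : 0 < |M.det| := abs_pos.2 hM
  have hne : Nonempty (Fin n × Fin m) := ⟨⟨⟨0, hn⟩, ⟨0, hm⟩⟩⟩
  have hr : (0 : ℝ) < Fintype.card (Fin n × Fin m) / p :=
    div_pos (by exact_mod_cast Fintype.card_pos) hp0
  have hn' : (0 : ℝ) < n := by exact_mod_cast hn
  have hm' : (0 : ℝ) < m := by exact_mod_cast hm
  rw [intAffineSurfaceArea_eq hQ hK', intAffineSurfaceArea_eq hQ hK]
  have h1 := sphereNegMean_comp_linearMap hp0 (measurable_projBodyIntegral hp0.le hQ (A '' K))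
    (fun c hc x => projBodyIntegral_smul hQ (A '' K) hc x) (ψ := leftMulMatrix M)
    (by rw [det_leftMulMatrix]; exact pow_ne_zero _ hM)
  have h2 : ∀ x, projBodyIntegral p Q (A '' K) (leftMulMatrix M x) =
      ENNReal.ofReal |M.det| * projBodyIntegral p Q K x := fun x => by
    rw [projBodyIntegral_image hn hQ hK A
      (fun v => rowMul_adjoint_leftMulMatrix hAM v x), hAdet]
  rw [funext h2] at h1
  rw [sphereNegMean_const_mul hr (by simpa using hM) ENNReal.ofReal_ne_top, det_leftMulMatrix]
    at h1
  set X := sphereNegMean (Fintype.card (Fin n × Fin m) / p) (projBodyIntegral p Q (A '' K))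
  set Y := sphereNegMean (Fintype.card (Fin n × Fin m) / p) (projBodyIntegral p Q K)
  have e1 : |M.det ^ m| ^ (p / (Fintype.card (Fin n × Fin m) : ℝ)) = |M.det| ^ (p / n) := by
    rw [abs_pow, ← Real.rpow_natCast, ← Real.rpow_mul hD.le]
    congr 1
    simp only [Fintype.card_prod, Fintype.card_fin, Nat.cast_mul]
    field_simp
  rw [e1] at h1
  have e2 : |M.det| ^ (((n : ℝ) - p) / n) = |M.det| ^ (-(p / n)) * |M.det| := by
    nth_rewrite 3 [← Real.rpow_one |M.det|]
    rw [← Real.rpow_add hD]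
    congr 1
    field_simp
    ring
  rw [e2, ENNReal.ofReal_mul (by positivity), mul_assoc, h1, ← mul_assoc,
    ← ENNReal.ofReal_mul (by positivity), ← Real.rpow_add hD]
  simp

theorem intAffineSurfaceArea_smul_left (hn : 0 < n) (hm : 0 < m) (hp : 1 ≤ p)
    {Q : Set (EuclideanSpace ℝ (Fin m))} (hQ : IsConvexBodyO Q)
    {K : Set (EuclideanSpace ℝ (Fin n))} (hK : ∀ z ∈ frontier K, radialFun K z = 1)
    {b : ℝ} (hb : 0 < b) :
    intAffineSurfaceArea p (b • Q) K =
      ENNReal.ofReal (b ^ p) * intAffineSurfaceArea p Q K := by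
  have hne : Nonempty (Fin n × Fin m) := ⟨⟨⟨0, hn⟩, ⟨0, hm⟩⟩⟩
  have hr : (0 : ℝ) < Fintype.card (Fin n × Fin m) / p :=
    div_pos (by exact_mod_cast Fintype.card_pos) (by positivity)
  have hbp : 0 < b ^ p := by positivity
  rw [intAffineSurfaceArea_eq (hQ.smul hb.ne') hK, intAffineSurfaceArea_eq hQ hK,
    ← sphereNegMean_const_mul hr (by simpa using hbp) ENNReal.ofReal_ne_top]
  congr 1
  ext x
  unfold projBodyIntegral
  rw [← lintegral_const_mul' _ _ ENNReal.ofReal_ne_top]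
  refine lintegral_congr fun z => ?_
  rw [supportFun_smul_set _ hb.le, Real.mul_rpow hb.le (hQ.supportFun_nonneg _),
    ← ENNReal.ofReal_mul hbp.le, mul_assoc]

/-- Since `h_{-Q}(y) = h_Q(-y)`, this is the linear change of variables `x ↦ -x`, whose determinant
has absolute value `1`. -/
theorem intAffineSurfaceArea_neg (hn : 0 < n) (hm : 0 < m) (hp : 1 ≤ p)
    {Q : Set (EuclideanSpace ℝ (Fin m))} (hQ : IsConvexBodyO Q)
    {K : Set (EuclideanSpace ℝ (Fin n))} (hK : ∀ z ∈ frontier K, radialFun K z = 1) :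
    intAffineSurfaceArea p (-Q) K = intAffineSurfaceArea p Q K := by
  have hp0 : 0 < p := by positivity
  have hne : Nonempty (Fin n × Fin m) := ⟨⟨⟨0, hn⟩, ⟨0, hm⟩⟩⟩
  have hneg : ∀ x : EuclideanSpace ℝ (Fin n × Fin m),
      projBodyIntegral p (-Q) K x = projBodyIntegral p Q K ((-LinearMap.id : _ →ₗ[ℝ] _) x) := by
    intro x
    unfold projBodyIntegral
    refine lintegral_congr fun z => ?_
    have : rowMul (-gradient (radialFun K) z) ((-LinearMap.id : _ →ₗ[ℝ] _) x) =
        -rowMul (-gradient (radialFun K) z) x := by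
      simpa using rowMul_smul_right (-1) (-gradient (radialFun K) z) x
    rw [supportFun_neg_set, this]
  have hdet : |LinearMap.det (-LinearMap.id : EuclideanSpace ℝ (Fin n × Fin m) →ₗ[ℝ] _)| = 1 := by
    rw [← neg_one_smul ℝ, LinearMap.det_smul, LinearMap.det_id]
    simp
  rw [intAffineSurfaceArea_eq hQ.neg hK, intAffineSurfaceArea_eq hQ hK, funext hneg,
    sphereNegMean_comp_linearMap hp0 (measurable_projBodyIntegral hp0.le hQ K)
      (fun c hc x => projBodyIntegral_smul hQ K hc x)
      (abs_pos.1 (hdet ▸ one_pos)), hdet]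
  simp

theorem add_projBodyIntegral_le_lpSum (hp : 1 ≤ p) {t : ℝ} (ht : t ∈ Icc (0 : ℝ) 1)
    {Q₁ Q₂ : Set (EuclideanSpace ℝ (Fin m))} (h₁ : IsConvexBodyO Q₁) (h₂ : IsConvexBodyO Q₂)
    (K : Set (EuclideanSpace ℝ (Fin n))) (x : EuclideanSpace ℝ (Fin n × Fin m)) :
    ENNReal.ofReal t * projBodyIntegral p Q₁ K x +
        ENNReal.ofReal (1 - t) * projBodyIntegral p Q₂ K x ≤
      projBodyIntegral p (lpSum p t Q₁ (1 - t) Q₂) K x := by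
  have ht' : 0 ≤ 1 - t := sub_nonneg.2 ht.2
  unfold projBodyIntegral
  rw [← lintegral_const_mul' _ _ ENNReal.ofReal_ne_top,
    ← lintegral_const_mul' _ _ ENNReal.ofReal_ne_top]
  refine (le_lintegral_add _ _).trans (lintegral_mono fun z => ?_)
  have a₁ := Real.rpow_nonneg (h₁.supportFun_nonneg (rowMul (-gradient (radialFun K) z) x)) p
  have a₂ := Real.rpow_nonneg (h₂.supportFun_nonneg (rowMul (-gradient (radialFun K) z) x)) p
  rw [supportFun_lpSum_rpow hp ht.1 ht' h₁ h₂, ← ENNReal.ofReal_mul ht.1,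
    ← ENNReal.ofReal_mul ht', ← ENNReal.ofReal_add (mul_nonneg ht.1 (by positivity))
      (mul_nonneg ht' (by positivity))]
  exact (congrArg ENNReal.ofReal (by ring)).le

theorem add_intAffineSurfaceArea_le_lpSum (hn : 0 < n) (hm : 0 < m) (hp : 1 ≤ p)
    {K : Set (EuclideanSpace ℝ (Fin n))} (hK : ∀ z ∈ frontier K, radialFun K z = 1)
    {t : ℝ} (ht : t ∈ Icc (0 : ℝ) 1) {Q₁ Q₂ : Set (EuclideanSpace ℝ (Fin m))}
    (h₁ : IsConvexBodyO Q₁) (h₂ : IsConvexBodyO Q₂) :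
    ENNReal.ofReal t * intAffineSurfaceArea p Q₁ K +
        ENNReal.ofReal (1 - t) * intAffineSurfaceArea p Q₂ K ≤
      intAffineSurfaceArea p (lpSum p t Q₁ (1 - t) Q₂) K := by
  have hne : Nonempty (Fin n × Fin m) := ⟨⟨⟨0, hn⟩, ⟨0, hm⟩⟩⟩
  have hp0 : 0 < p := by positivity
  have hr : (0 : ℝ) < Fintype.card (Fin n × Fin m) / p :=
    div_pos (by exact_mod_cast Fintype.card_pos) hp0
  have hle := add_projBodyIntegral_le_lpSum hp ht h₁ h₂ K
  rw [intAffineSurfaceArea_eq h₁ hK, intAffineSurfaceArea_eq h₂ hK,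
    intAffineSurfaceArea_eq (isConvexBodyO_lpSum hp ht.1 (sub_nonneg.2 ht.2)
      (by linarith) h₁ h₂) hK]
  -- At `t = 0` and `t = 1` a coefficient vanishes and cannot be moved into the mean; there the
  -- claim reduces to monotonicity.
  rcases eq_or_lt_of_le ht.1 with rfl | ht0
  · simpa using sphereNegMean_mono hr fun x => by simpa using hle x
  rcases eq_or_lt_of_le ht.2 with rfl | ht1
  · simpa using sphereNegMean_mono hr fun x => by simpa using hle x
  · rw [← sphereNegMean_const_mul hr (by simpa using ht0) ENNReal.ofReal_ne_top,
      ← sphereNegMean_const_mul hr (by simpa using ht1) ENNReal.ofReal_ne_top]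
    exact (sphereNegMean_add_le hr
      ((measurable_projBodyIntegral hp0.le h₁ K).const_mul _)).trans (sphereNegMean_mono hr hle)

end IntAffineSurfaceArea

theorem proposition5p3 (n m : ℕ) (hn : 0 < n) (hm : 0 < m) (p : ℝ) (hp : 1 ≤ p)
    (Q : Set (EuclideanSpace ℝ (Fin m))) (hQ : IsConvexBodyO Q)
    (K : Set (EuclideanSpace ℝ (Fin n))) (hK : IsLipschitzStarBody K) :
    (∀ a b : ℝ, 0 < a → 0 < b →
      intAffineSurfaceArea p (b • Q) (a • K) =
        ENNReal.ofReal (b ^ p * a ^ ((n : ℝ) - p)) * intAffineSurfaceArea p Q K) ∧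
    intAffineSurfaceArea p Q K = intAffineSurfaceArea p (-Q) K ∧
    (∀ t ∈ Icc (0 : ℝ) 1, ∀ Q₁ Q₂ : Set (EuclideanSpace ℝ (Fin m)),
      IsConvexBodyO Q₁ → IsConvexBodyO Q₂ →
      ENNReal.ofReal t * intAffineSurfaceArea p Q₁ K +
          ENNReal.ofReal (1 - t) * intAffineSurfaceArea p Q₂ K ≤
        intAffineSurfaceArea p (lpSum p t Q₁ (1 - t) Q₂) K) ∧
    (∀ φ : GL (Fin n) ℝ,
      intAffineSurfaceArea p Q
          (Matrix.toEuclideanLin (φ : Matrix (Fin n) (Fin n) ℝ) '' K) =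
        ENNReal.ofReal (|(φ : Matrix (Fin n) (Fin n) ℝ).det| ^ (((n : ℝ) - p) / n)) *
          intAffineSurfaceArea p Q K) := by
  have hK1 : ∀ z ∈ frontier K, radialFun K z = 1 := fun z hz => hK.radialFun_eq_one hn hz
  refine ⟨fun a b ha hb => ?_, (intAffineSurfaceArea_neg hn hm hp hQ hK1).symm,
    fun t ht Q₁ Q₂ h₁ h₂ => add_intAffineSurfaceArea_le_lpSum hn hm hp hK1 ht h₁ h₂,
    fun φ => (intAffineSurfaceArea_image hn hm hp hQ hK1
      ((Matrix.isUnit_iff_isUnit_det _).1 φ.isUnit).ne_zero).2⟩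
  -- Dilation by `a` is the linear map `a·1` of determinant `a^n`, and `(a^n)^{(n-p)/n} = a^{n-p}`.
  have hdet : (a • (1 : Matrix (Fin n) (Fin n) ℝ)).det = a ^ n := by
    rw [Matrix.det_smul, Matrix.det_one, mul_one, Fintype.card_fin]
  have himg : Matrix.toEuclideanLin (a • (1 : Matrix (Fin n) (Fin n) ℝ)) '' K = a • K := by
    rw [map_smul, Matrix.toLpLin_one, ← image_smul]
    rfl
  obtain ⟨h1, h2⟩ := intAffineSurfaceArea_image hn hm hp hQ hK1
    (M := a • (1 : Matrix (Fin n) (Fin n) ℝ)) (by rw [hdet]; positivity)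
  rw [himg] at h1 h2
  have hn' : (n : ℝ) ≠ 0 := by exact_mod_cast hn.ne'
  have hpow : |a ^ n| ^ (((n : ℝ) - p) / n) = a ^ ((n : ℝ) - p) := by
    rw [abs_of_pos (by positivity), ← Real.rpow_natCast, ← Real.rpow_mul ha.le]
    congr 1
    field_simp
  rw [intAffineSurfaceArea_smul_left hn hm hp hQ h1 hb, h2, hdet, hpow, ← mul_assoc,
    ← ENNReal.ofReal_mul (by positivity)]
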